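/- Let $n\in\{2,3\}$, $\mu>0$, $\nu>0$, and let $m\ge 3$ be an integer. Let $v^0,H^0:\mathbb R^n\to\mathbb R^n$ be divergence-free vector fields in $H^m(\mathbb R^n)\cap L^1(\mathbb R^n)$. For each $\varepsilon>0$ let $(v^\varepsilon,H^\varepsilon)\in C^0([0,\infty),H^m\times H^m)$ be the classical solution of the linear Cauchy problem $$v_t-\mu\Delta v=\varepsilon^{-1}\partial_1H,\qquad H_t-\nu\Delta H=\varepsilon^{-1}\partial_1v\quad\text{in }\mathbb R^n\times(0,\infty),\qquad (v,H)|_{t=0}=(v^0,H^0).$$ (1) For every $x\in\mathbb R^n$ and every $t>0$, $(v^\varepsilon,H^\varepsilon)(x,t)\to 0$ as $\varepsilon\to0^+$. (2) For $R>0$ put $S_R=\{x\in\mathbb R^n : |x_1|<R\}$. For every $\theta\in(0,1)$, $R>0$, integer $l\ge1$ and $t_0>0$ there is a constant $C>0$, depending only on $\mu,\nu,n,m,\theta,R,l,t_0$, such that, whenever $v^0$ and $H^0$ are moreover supported in $S_R$, $$\|(v^\varepsilon,H^\varepsilon)(t)\|_{L^\infty(S_{lR})}\le C\,\varepsilon^{\theta}\,\|(v^0,H^0)\|_{L^1(\mathbb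 R^n)}\qquad\text{for all } t>t_0 \text{ and } \varepsilon\in(0,1).$$ -/

import Mathlib

open MeasureTheory Set Filter Topology
open scoped ENNReal ContDiff

noncomputable section

/-- The Euclidean space `ℝⁿ`. -/
abbrev Rn (n : ℕ) : Type := EuclideanSpace ℝ (Fin n)

/-- The unit vector `e¹` of `ℝⁿ` (the first coordinate has index `0`). -/
def e1 (n : ℕ) [NeZero n] : Rn n := EuclideanSpace.single 0 1

/-- The slab `S_R = {x ∈ ℝⁿ : |x₁| < R}`. -/
def slab (n : ℕ) [NeZero n] (R : ℝ) : Set (Rn n) := {x | |x 0| < R}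

/-- `g` is the weak derivative `∂_{i 0} ∂_{i 1} ⋯ ∂_{i (k-1)} f` of order `k` of `f` on `ℝⁿ`.
Every multi-index `α` with `|α| = k` is represented by a tuple `i : Fin k → Fin n`. -/
def HasWeakDeriv {n k : ℕ} (i : Fin k → Fin n) (f g : Rn n → Rn n) : Prop :=
  LocallyIntegrable f volume ∧ LocallyIntegrable g volume ∧
    ∀ φ : Rn n → ℝ, ContDiff ℝ ∞ φ → HasCompactSupport φ →
      ∫ x, (iteratedFDeriv ℝ k φ x fun j => EuclideanSpace.single (i j) 1) • f x =
        (-1 : ℝ) ^ k • ∫ x, φ x • g x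

/-- The Sobolev space `H^m = W^{m,2}(ℝⁿ)` of vector fields. -/
def MemHm {n : ℕ} (m : ℕ) (f : Rn n → Rn n) : Prop :=
  ∀ k ≤ m, ∀ i : Fin k → Fin n, ∃ g : Rn n → Rn n, MemLp g 2 volume ∧ HasWeakDeriv i f g

/-- `div f = 0` in the sense of distributions on `ℝⁿ`. -/
def WeakDivFree {n : ℕ} (f : Rn n → Rn n) : Prop :=
  ∀ φ : Rn n → ℝ, ContDiff ℝ ∞ φ → HasCompactSupport φ → ∫ x, fderiv ℝ φ x (f x) = 0

/-- The space `H^m_σ = {w ∈ H^m : div w = 0}`. -/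
def MemHmSigma {n : ℕ} (m : ℕ) (f : Rn n → Rn n) : Prop :=
  MemHm m f ∧ WeakDivFree f

/-- `w ∈ C⁰([0,∞), H^m)`: for each time `t ≥ 0` all weak derivatives of `w t` of order at most `m`
exist in `L²`, and they depend continuously on `t ∈ [0,∞)` in the norm of `L²`. -/
def ContinuousInHm {n : ℕ} (m : ℕ) (w : ℝ → Rn n → Rn n) : Prop :=
  ∀ k ≤ m, ∀ i : Fin k → Fin n, ∃ g : ℝ → Lp (Rn n) 2 (volume : Measure (Rn n)),
    ContinuousOn g (Ici 0) ∧ ∀ t, 0 ≤ t → HasWeakDeriv i (w t) (g t)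

/-- The regularity of a classical solution of a second order parabolic problem: `w` is continuous
on `[0,∞) × ℝⁿ`, and its derivatives of order one in time and of order at most two in space exist
and are continuous on `(0,∞) × ℝⁿ`. -/
structure IsClassical {n : ℕ} (w : ℝ → Rn n → Rn n) : Prop where
  continuousOn : ContinuousOn (fun p : ℝ × Rn n => w p.1 p.2) (Ici 0 ×ˢ univ)
  differentiableAt_time : ∀ t, 0 < t → ∀ x, DifferentiableAt ℝ (fun s => w s x) t
  contDiff_space : ∀ t, 0 < t → ContDiff ℝ 2 (w t)
  continuousOn_time :
    ContinuousOn (fun p : ℝ × Rn n => deriv (fun s => w s p.2) p.1) (Ioi 0 ×ˢ univ)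
  continuousOn_space : ∀ k ≤ 2,
    ContinuousOn (fun p : ℝ × Rn n => iteratedFDeriv ℝ k (w p.1) p.2) (Ioi 0 ×ˢ univ)

/-- `(v, H)` is a classical solution, with `v, H ∈ C⁰([0,∞), H^m)`, of the linear problem
`v_t - μ Δv = ε⁻¹ ∂₁H`, `H_t - ν ΔH = ε⁻¹ ∂₁v` on `ℝⁿ × (0,∞)` with the initial data `(v⁰, H⁰)`. -/
structure IsLinearSolution {n : ℕ} [NeZero n] (m : ℕ) (μ ν ε : ℝ) (v0 H0 : Rn n → Rn n)
    (v H : ℝ → Rn n → Rn n) : Prop where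
  continuousInHm_v : ContinuousInHm m v
  continuousInHm_H : ContinuousInHm m H
  isClassical_v : IsClassical v
  isClassical_H : IsClassical H
  eq_v : ∀ t, 0 < t → ∀ x,
    deriv (fun s => v s x) t - μ • Laplacian.laplacian (v t) x =
      ε⁻¹ • fderiv ℝ (H t) x (e1 n)
  eq_H : ∀ t, 0 < t → ∀ x,
    deriv (fun s => H s x) t - ν • Laplacian.laplacian (H t) x =
      ε⁻¹ • fderiv ℝ (v t) x (e1 n)
  init_v : v 0 =ᵐ[volume] v0
  init_H : H 0 =ᵐ[volume] H0

end

/-! For each coordinate `i` the pair `(v_i + H_i, v_i - H_i)` solves a 2×2 system `W_t = A ΔW + B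
∂₁W` with self-adjoint constant matrices: `A` has diagonal entries `a = (μ+ν)/2` and off-diagonal
entries `b = (μ-ν)/2`, and `B = diag(1/ε, -1/ε)`. At the frequency `ξ` both components are damped at
the rate `4π²a|ξ|²`, rotate in opposite directions with frequency `2π ξ₀/ε`, and are coupled with
strength `4π²b|ξ|²`. Fast rotation averages the coupling out (`coupled_ode_averaging`), so that the
components evolve almost independently.

The averaging error carries a factor `ε/|ξ₀|`, which is not integrable across `ξ₀ = 0`.
Interpolation with the trivial bound replaces it by `(ε/|ξ₀|)^θ` with `θ < 1`, which is locally
integrable, and `|b| < a` leaves a Gaussian at infinity. Integration over `ξ` gives an error of size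
`C ε^θ` times the `L¹` norm of the data, uniformly for `t ≥ t₀` (`integral_averagingWeight_le`).
This is where the rate `ε^θ` comes from.

Without coupling, each component is the heat flow of diffusivity `a`, translated by `± t/ε` along
`e¹`. The translated kernel tends to zero at every point, so dominated convergence gives (1). If the
data live in one slab and the solution is observed in another, the kernel is even `O(ε²)`
(`heatKernel_transported_le`), which gives (2).

It must also be shown that a given classical solution is the Fourier multiplier applied to its data.
This is a uniqueness argument by duality (`integral_inner_dualSolution`): the solution is paired
with the time-reversed solution of the adjoint problem, whose Fourier transform is smooth with
compact support. Spatial cutoffs justify the integrations by parts, and the `L²` bounds make their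
contribution vanish. -/

noncomputable section

set_option linter.unusedSectionVars false

/-! ### Averaging for two damped, counter-rotating, coupled oscillators -/

section OscillatorSystem

variable {s d κ : ℝ} {y z : ℝ → ℂ}

/-- Energy decay for the symmetric part of the diagonalised system. -/
theorem coupled_ode_energy
    (hy : ∀ r, HasDerivAt y ((-s + κ * Complex.I) * y r - d * z r) r)
    (hz : ∀ r, HasDerivAt z ((-s - κ * Complex.I) * z r - d * y r) r) {t : ℝ} (ht : 0 ≤ t) :
    ‖y t‖ ^ 2 + ‖z t‖ ^ 2 ≤
      Real.exp (-(s - |d|) * t) ^ 2 * (‖y 0‖ ^ 2 + ‖z 0‖ ^ 2) := by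
  have key : Antitone fun r => Real.exp (2 * (s - |d|) * r) * (‖y r‖ ^ 2 + ‖z r‖ ^ 2) := by
    have hder : ∀ r, HasDerivAt
        (fun r => Real.exp (2 * (s - |d|) * r) * (‖y r‖ ^ 2 + ‖z r‖ ^ 2))
        (Real.exp (2 * (s - |d|) * r) * (2 * (s - |d|)) * (‖y r‖ ^ 2 + ‖z r‖ ^ 2) +
          Real.exp (2 * (s - |d|) * r) *
            (2 * inner ℝ (y r) ((-s + κ * Complex.I) * y r - d * z r) +
              2 * inner ℝ (z r) ((-s - κ * Complex.I) * z r - d * y r))) r := by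
      intro r
      have h1 : HasDerivAt (fun r : ℝ => Real.exp (2 * (s - |d|) * r))
          (Real.exp (2 * (s - |d|) * r) * (2 * (s - |d|))) r := by
        simpa using ((hasDerivAt_id r).const_mul (2 * (s - |d|))).exp
      exact h1.mul ((hy r).norm_sq.add (hz r).norm_sq)
    refine antitone_of_deriv_nonpos (fun r => (hder r).differentiableAt) fun r => ?_
    rw [(hder r).deriv]
    -- The rotation by `κ` is skew-symmetric and drops out of the energy balance; only damping and
    -- coupling remain.
    have e : (Real.exp (2 * (s - |d|) * r) * (2 * (s - |d|)) * (‖y r‖ ^ 2 + ‖z r‖ ^ 2) +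
          Real.exp (2 * (s - |d|) * r) *
            (2 * inner ℝ (y r) ((-s + κ * Complex.I) * y r - d * z r) +
              2 * inner ℝ (z r) ((-s - κ * Complex.I) * z r - d * y r))) =
        -2 * Real.exp (2 * (s - |d|) * r) * (|d| * (‖y r‖ ^ 2 + ‖z r‖ ^ 2) +
          2 * d * ((y r).re * (z r).re + (y r).im * (z r).im)) := by
      simp only [Complex.inner, ← Complex.normSq_eq_norm_sq, Complex.normSq_apply]
      simp
      ring
    rw [e]
    -- According to the sign of `d`, this is `|d|` times `|y + z|²` or `|y - z|²`.
    have h2 : 0 ≤ |d| * (‖y r‖ ^ 2 + ‖z r‖ ^ 2) +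
          2 * d * ((y r).re * (z r).re + (y r).im * (z r).im) := by
      simp only [← Complex.normSq_eq_norm_sq, Complex.normSq_apply]
      rcases abs_cases d with ⟨h, h'⟩ | ⟨h, h'⟩ <;> rw [h]
      · nlinarith [mul_nonneg h' (sq_nonneg ((y r).re + (z r).re)),
          mul_nonneg h' (sq_nonneg ((y r).im + (z r).im))]
      · have h'' : 0 ≤ -d := by linarith
        nlinarith [mul_nonneg h'' (sq_nonneg ((y r).re - (z r).re)),
          mul_nonneg h'' (sq_nonneg ((y r).im - (z r).im))]
    nlinarith [mul_nonneg (Real.exp_pos (2 * (s - |d|) * r)).le h2]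
  have h := key ht
  simp only [mul_zero, Real.exp_zero, one_mul] at h
  have h3 : Real.exp (-(s - |d|) * t) ^ 2 * Real.exp (2 * (s - |d|) * t) = 1 := by
    rw [← Real.exp_nat_mul, ← Real.exp_add]
    simp; ring
  calc ‖y t‖ ^ 2 + ‖z t‖ ^ 2 = Real.exp (-(s - |d|) * t) ^ 2 *
        (Real.exp (2 * (s - |d|) * t) * (‖y t‖ ^ 2 + ‖z t‖ ^ 2)) := by
        rw [← mul_assoc, h3, one_mul]
    _ ≤ _ := by gcongr

theorem coupled_ode_norm_le
    (hy : ∀ r, HasDerivAt y ((-s + κ * Complex.I) * y r - d * z r) r)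
    (hz : ∀ r, HasDerivAt z ((-s - κ * Complex.I) * z r - d * y r) r) {t : ℝ} (ht : 0 ≤ t) :
    ‖y t‖ ≤ Real.exp (-(s - |d|) * t) * (‖y 0‖ + ‖z 0‖) ∧
      ‖z t‖ ≤ Real.exp (-(s - |d|) * t) * (‖y 0‖ + ‖z 0‖) := by
  have h := coupled_ode_energy hy hz ht
  have h0 : 0 ≤ Real.exp (-(s - |d|) * t) * (‖y 0‖ + ‖z 0‖) := by positivity
  have h1 : Real.exp (-(s - |d|) * t) ^ 2 * (‖y 0‖ ^ 2 + ‖z 0‖ ^ 2) ≤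
      (Real.exp (-(s - |d|) * t) * (‖y 0‖ + ‖z 0‖)) ^ 2 := by
    rw [mul_pow]
    gcongr
    nlinarith [norm_nonneg (y 0), norm_nonneg (z 0),
      mul_nonneg (norm_nonneg (y 0)) (norm_nonneg (z 0))]
  exact ⟨abs_le_of_sq_le_sq' (by nlinarith [sq_nonneg ‖z t‖]) h0 |>.2,
    abs_le_of_sq_le_sq' (by nlinarith [sq_nonneg ‖y t‖]) h0 |>.2⟩

theorem norm_cexp_neg_add_mul_I (s κ t : ℝ) :
    ‖Complex.exp ((-s + κ * Complex.I) * t)‖ = Real.exp (-s * t) := by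
  rw [Complex.norm_exp]; simp

/-- The off-diagonal coupling `d` of the two components is averaged out by the rotation at
frequency `κ`, up to a relative error `|d| (1 + t |d|) / |κ|`. -/
theorem coupled_ode_averaging (hκ : κ ≠ 0)
    (hy : ∀ r, HasDerivAt y ((-s + κ * Complex.I) * y r - d * z r) r)
    (hz : ∀ r, HasDerivAt z ((-s - κ * Complex.I) * z r - d * y r) r) {t : ℝ} (ht : 0 ≤ t) :
    ‖y t - Complex.exp ((-s + κ * Complex.I) * t) * y 0‖ ≤
      Real.exp (-(s - |d|) * t) * (|d| / |κ| * (1 + t * |d|)) * (‖y 0‖ + ‖z 0‖) := by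
  have hκ' : (κ : ℂ) ≠ 0 := by exact_mod_cast hκ
  have hexp : ∀ (c : ℂ) (r : ℝ), HasDerivAt (fun r : ℝ => Complex.exp (c * r))
      (Complex.exp (c * r) * c) r := by
    intro c r
    have : HasDerivAt (fun r : ℝ => c * (r : ℂ)) c r := by
      simpa using (Complex.ofRealCLM.hasDerivAt (x := r)).const_mul c
    exact this.cexp
  set N := ‖y 0‖ + ‖z 0‖ with hN
  have hN0 : 0 ≤ N := by positivity
  -- One normal form step. Undoing damping and rotation in `y` leaves the forcing `-d e^{(s-iκ)r}
  -- z`, which oscillates at frequency `2κ`. The second term of `u` is its primitive to leading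
  -- order, so `u'` is only of size `d²/|κ|`.
  let u : ℝ → ℂ := fun r => Complex.exp ((s - κ * Complex.I) * r) * y r -
    d / (2 * Complex.I * κ) * (Complex.exp ((s - κ * Complex.I) * r) * z r)
  have hu : ∀ r : ℝ, HasDerivAt u
      (d ^ 2 / (2 * Complex.I * κ) * (Complex.exp ((s - κ * Complex.I) * r) * y r)) r := by
    intro r
    have := ((hexp (s - κ * Complex.I) r).mul (hy r)).sub
      (((hexp (s - κ * Complex.I) r).mul (hz r)).const_mul ((d : ℂ) / (2 * Complex.I * κ)))
    refine this.congr_deriv ?_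
    field_simp
    ring_nf
  have hnexp : ∀ r : ℝ, ‖Complex.exp ((s - κ * Complex.I) * r)‖ = Real.exp (s * r) := by
    intro r
    rw [Complex.norm_exp]; simp
  have hnI : ‖(2 * Complex.I * κ : ℂ)‖ = 2 * |κ| := by simp
  have hκp : 0 < |κ| := abs_pos.2 hκ
  have hmul : ∀ r, Real.exp (s * r) * Real.exp (-(s - |d|) * r) = Real.exp (|d| * r) := by
    intro r; rw [← Real.exp_add]; ring_nf
  have hmvt : ‖u t - u 0‖ ≤ d ^ 2 / (2 * |κ|) * (Real.exp (|d| * t) * N) * (t - 0) := by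
    refine norm_image_sub_le_of_norm_deriv_le_segment' (f := u)
      (fun r _ => (hu r).hasDerivWithinAt) (fun r hr => ?_) t ⟨ht, le_rfl⟩
    rw [norm_mul, norm_mul, hnexp, norm_div, hnI, norm_pow, Complex.norm_real, Real.norm_eq_abs,
      sq_abs]
    refine mul_le_mul_of_nonneg_left ?_ (by positivity)
    calc Real.exp (s * r) * ‖y r‖ ≤ Real.exp (s * r) * (Real.exp (-(s - |d|) * r) * N) := by
          gcongr; exact (coupled_ode_norm_le hy hz hr.1).1
      _ = Real.exp (|d| * r) * N := by rw [← mul_assoc, hmul]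
      _ ≤ _ := by
          have := hr.2.le
          gcongr
  have hcancel : Complex.exp ((-s + κ * Complex.I) * t) * Complex.exp ((s - κ * Complex.I) * t)
      = 1 := by
    rw [← Complex.exp_add]
    ring_nf; simp
  have hrep : y t - Complex.exp ((-s + κ * Complex.I) * t) * y 0 =
      Complex.exp ((-s + κ * Complex.I) * t) * ((u t - u 0) +
        d / (2 * Complex.I * κ) * (Complex.exp ((s - κ * Complex.I) * t) * z t) -
        d / (2 * Complex.I * κ) * z 0) := by
    simp only [u]
    simp only [Complex.ofReal_zero, mul_zero, Complex.exp_zero, one_mul]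
    linear_combination (-y t) * hcancel
  rw [hrep, norm_mul, norm_cexp_neg_add_mul_I]
  have hz1 : ‖Complex.exp ((s - κ * Complex.I) * t) * z t‖ ≤ Real.exp (|d| * t) * N := by
    rw [norm_mul, hnexp, ← hmul, mul_assoc]
    gcongr
    exact (coupled_ode_norm_le hy hz ht).2
  have hz0 : ‖z 0‖ ≤ Real.exp (|d| * t) * N := by
    have h1 : 1 ≤ Real.exp (|d| * t) := Real.one_le_exp (by positivity)
    have : ‖z 0‖ ≤ N := by rw [hN]; linarith [norm_nonneg (y 0)]
    nlinarith
  have hnd : ‖(d / (2 * Complex.I * κ) : ℂ)‖ = |d| / (2 * |κ|) := by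
    rw [norm_div, hnI, Complex.norm_real, Real.norm_eq_abs]
  calc _ ≤ Real.exp (-s * t) * (d ^ 2 / (2 * |κ|) * (Real.exp (|d| * t) * N) * (t - 0) +
        |d| / (2 * |κ|) * (Real.exp (|d| * t) * N) +
        |d| / (2 * |κ|) * (Real.exp (|d| * t) * N)) := by
        gcongr
        refine (norm_sub_le _ _).trans (add_le_add ((norm_add_le _ _).trans
          (add_le_add hmvt ?_)) ?_)
        · rw [norm_mul, hnd]; gcongr
        · rw [norm_mul, hnd]; gcongr
    _ = (Real.exp (-s * t) * Real.exp (|d| * t)) * (|d| / |κ| * (1 + t * |d| / 2)) * N := by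
        rw [← sq_abs d]; field_simp; ring
    _ ≤ _ := by
        rw [← Real.exp_add, show -s * t + |d| * t = -(s - |d|) * t by ring]
        gcongr
        have : 0 ≤ t * |d| := by positivity
        linarith

/-- The averaging estimate, interpolated with the trivial bound. -/
theorem coupled_ode_averaging_rpow (hκ : κ ≠ 0) {θ : ℝ} (hθ : 0 < θ) (hθ1 : θ < 1)
    (hy : ∀ r, HasDerivAt y ((-s + κ * Complex.I) * y r - d * z r) r)
    (hz : ∀ r, HasDerivAt z ((-s - κ * Complex.I) * z r - d * y r) r) {t : ℝ} (ht : 0 ≤ t) :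
    ‖y t - Complex.exp ((-s + κ * Complex.I) * t) * y 0‖ ≤
      2 * Real.exp (-(s - |d|) * t) * (|d| / |κ| * (1 + t * |d|)) ^ θ * (‖y 0‖ + ‖z 0‖) := by
  set X := |d| / |κ| * (1 + t * |d|) with hX
  have hX0 : 0 ≤ X := by positivity
  set N := ‖y 0‖ + ‖z 0‖ with hN
  have hN0 : 0 ≤ N := by positivity
  rcases le_total X 1 with h | h
  · refine (coupled_ode_averaging hκ hy hz ht).trans ?_
    have h1 : X ≤ 2 * X ^ θ := by
      have : X ^ (1 : ℝ) ≤ X ^ θ := Real.rpow_le_rpow_of_exponent_ge' hX0 h hθ.le hθ1.le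
      rw [Real.rpow_one] at this
      have := Real.rpow_nonneg hX0 θ
      linarith
    rw [← hX, ← hN, mul_comm 2 (Real.exp _), mul_assoc (Real.exp _) 2]
    gcongr
  · have h1 : 1 ≤ X ^ θ := Real.one_le_rpow h hθ.le
    have h2 : ‖Complex.exp ((-s + κ * Complex.I) * t) * y 0‖ ≤
        Real.exp (-(s - |d|) * t) * N := by
      rw [norm_mul, norm_cexp_neg_add_mul_I]
      gcongr
      · have := abs_nonneg d; linarith
      · rw [hN]; linarith [norm_nonneg (z 0)]
    calc _ ≤ Real.exp (-(s - |d|) * t) * N + Real.exp (-(s - |d|) * t) * N :=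
          (norm_sub_le _ _).trans (add_le_add (coupled_ode_norm_le hy hz ht).1 h2)
      _ = 2 * Real.exp (-(s - |d|) * t) * 1 * N := by ring
      _ ≤ _ := by gcongr

end OscillatorSystem

/-! ### Integrability in frequency of the averaging error -/

section SymbolWeight

theorem integrable_abs_rpow_mul_exp_neg_mul_sq {b : ℝ} (hb : 0 < b) {s : ℝ} (hs : -1 < s) :
    Integrable fun x : ℝ => |x| ^ s * Real.exp (-b * x ^ 2) := by
  have h := integrableOn_rpow_mul_exp_neg_mul_sq hb hs
  have h1 : IntegrableOn (fun x : ℝ => |x| ^ s * Real.exp (-b * x ^ 2)) (Ioi 0) :=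
    h.congr_fun (fun x hx => by simp only [abs_of_pos (mem_Ioi.1 hx)]) measurableSet_Ioi
  rw [← integrableOn_univ, ← @Iio_union_Ici _ _ (0 : ℝ), integrableOn_union,
    integrableOn_Ici_iff_integrableOn_Ioi]
  refine ⟨?_, h1⟩
  rw [← (Measure.measurePreserving_neg (volume : Measure ℝ)).integrableOn_comp_preimage
      (Homeomorph.neg ℝ).measurableEmbedding]
  simpa only [Function.comp_def, neg_sq, neg_preimage, neg_Iio, neg_zero, abs_neg] using h1

variable {n : ℕ} [NeZero n]

/-- The integrand is a product of functions of one coordinate each; only the factor in coordinate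
`0` is singular, and `θ < 1` makes it integrable at the origin. -/
theorem integrable_exp_neg_mul_normSq_mul_abs_rpow {b : ℝ} (hb : 0 < b) {θ : ℝ} (hθ : θ < 1) :
    Integrable fun ξ : Rn n => Real.exp (-b * ‖ξ‖ ^ 2) * |ξ 0| ^ (-θ) := by
  rw [← (PiLp.volume_preserving_toLp (Fin n)).integrable_comp_emb
    (MeasurableEquiv.toLp 2 _).measurableEmbedding]
  let f : Fin n → ℝ → ℝ := fun i x => (if i = 0 then |x| ^ (-θ) else 1) * Real.exp (-b * x ^ 2)
  have hf : ∀ i, Integrable (f i) := by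
    intro i
    by_cases hi : i = 0
    · simpa [f, hi] using integrable_abs_rpow_mul_exp_neg_mul_sq hb (s := -θ) (by linarith)
    · simpa [f, hi] using integrable_exp_neg_mul_sq hb
  refine (Integrable.fintype_prod (μ := fun _ => volume) hf).congr (Eventually.of_forall fun x => ?_)
  simp only [f, Finset.prod_mul_distrib, Function.comp_apply, EuclideanSpace.norm_sq_eq,
    Real.norm_eq_abs, sq_abs, Finset.prod_ite_eq', Finset.mem_univ, if_true, Finset.mul_sum,
    Real.exp_sum]
  rw [mul_comm]

theorem ae_coord_zero_ne_zero : ∀ᵐ ξ : Rn n, ξ 0 ≠ 0 := by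
  let f : Rn n →ₗ[ℝ] ℝ := (EuclideanSpace.proj (0 : Fin n)).toLinearMap
  have h : LinearMap.ker f ≠ ⊤ := by
    intro h
    have h1 : (e1 n) ∈ LinearMap.ker f := h ▸ Submodule.mem_top
    simp [f, e1] at h1
  have := Measure.addHaar_submodule (volume : Measure (Rn n)) _ h
  rw [ae_iff]
  convert this using 2
  ext ξ
  simp [f]

/-- Half of the exponential decay pays for the polynomial growth, and the other half is kept. The
constant does not depend on `θ`, because `Y ^ θ ≤ 1 + Y`. -/
theorem exists_bound_poly_mul_exp_neg {β c : ℝ} (hβ : 0 ≤ β) (hc : 0 < c) :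
    ∃ K : ℝ, 0 < K ∧ ∀ θ : ℝ, 0 < θ → θ < 1 → ∀ u : ℝ, 0 ≤ u →
      Real.exp (-c * u) * (β * u * (1 + β * u)) ^ θ ≤ K * Real.exp (-(c / 2) * u) := by
  -- The coefficients are chosen so that, against the Taylor terms `cu/2` and `(cu/2)²/2` of `exp
  -- (cu/2)`, they produce exactly `βu` and `β²u²`.
  refine ⟨1 + 2 * β / c + 8 * β ^ 2 / c ^ 2, by positivity, fun θ hθ hθ1 u hu => ?_⟩
  set Y := β * u * (1 + β * u) with hY
  have hY0 : 0 ≤ Y := by positivity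
  have h1 : Y ^ θ ≤ 1 + Y := by
    rcases le_total Y 1 with h | h
    · exact (Real.rpow_le_one hY0 h hθ.le).trans (by linarith)
    · have := Real.rpow_le_rpow_of_exponent_le h hθ1.le
      rw [Real.rpow_one] at this
      linarith
  have h2 : 1 + Y ≤ (1 + 2 * β / c + 8 * β ^ 2 / c ^ 2) * Real.exp (c / 2 * u) := by
    have h3 : 1 + c / 2 * u + (c / 2 * u) ^ 2 / 2 ≤ Real.exp (c / 2 * u) :=
      Real.quadratic_le_exp_of_nonneg (by positivity)
    calc 1 + Y ≤ (1 + 2 * β / c + 8 * β ^ 2 / c ^ 2) *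
          (1 + c / 2 * u + (c / 2 * u) ^ 2 / 2) := by
          have : (1 + 2 * β / c + 8 * β ^ 2 / c ^ 2) * (1 + c / 2 * u + (c / 2 * u) ^ 2 / 2) =
            1 + Y + (c / 2 * u + (c / 2 * u) ^ 2 / 2 + 2 * β / c * (1 + (c / 2 * u) ^ 2 / 2)
              + 8 * β ^ 2 / c ^ 2 * (1 + c / 2 * u)) := by
            rw [hY]; field_simp; ring
          rw [this]
          have : 0 ≤ (c / 2 * u + (c / 2 * u) ^ 2 / 2 + 2 * β / c * (1 + (c / 2 * u) ^ 2 / 2)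
              + 8 * β ^ 2 / c ^ 2 * (1 + c / 2 * u)) := by positivity
          linarith
      _ ≤ _ := by gcongr
  calc Real.exp (-c * u) * Y ^ θ ≤ Real.exp (-c * u) *
        ((1 + 2 * β / c + 8 * β ^ 2 / c ^ 2) * Real.exp (c / 2 * u)) := by
        gcongr; exact h1.trans h2
    _ = (1 + 2 * β / c + 8 * β ^ 2 / c ^ 2) * (Real.exp (-c * u) * Real.exp (c / 2 * u)) := by ring
    _ = _ := by rw [← Real.exp_add]; ring_nf

/-- The averaging error of the symbol at time `t`, for the wave speed `1 / ε`. -/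
def averagingWeight (a b ε θ t : ℝ) (ξ : Rn n) : ℝ :=
  2 * Real.exp (-(4 * Real.pi ^ 2 * a * ‖ξ‖ ^ 2 - |4 * Real.pi ^ 2 * b * ‖ξ‖ ^ 2|) * t) *
    (|4 * Real.pi ^ 2 * b * ‖ξ‖ ^ 2| / |2 * Real.pi * ξ 0 / ε| *
      (1 + t * |4 * Real.pi ^ 2 * b * ‖ξ‖ ^ 2|)) ^ θ

/-- In the scaling variable `u = 4π²|ξ|²t` the damping exponent is `(a-|b|)u`, and the averaging
error is at most `|b|u(1+|b|u)` times `ε/(t|ξ₀|)`. The preceding estimate then absorbs the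
polynomial in `u`. -/
theorem averagingWeight_le {a b : ℝ} (hab : |b| < a) :
    ∃ K c : ℝ, 0 < K ∧ 0 < c ∧ ∀ θ : ℝ, 0 < θ → θ < 1 → ∀ ε t : ℝ, 0 < ε → 0 < t → ∀ ξ : Rn n,
      ξ 0 ≠ 0 → averagingWeight a b ε θ t ξ ≤
        K * t ^ (-θ) * ε ^ θ * (Real.exp (-(c * t) * ‖ξ‖ ^ 2) * |ξ 0| ^ (-θ)) := by
  obtain ⟨K, hK, h⟩ := exists_bound_poly_mul_exp_neg (abs_nonneg b) (sub_pos.2 hab)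
  refine ⟨2 * K, 2 * Real.pi ^ 2 * (a - |b|), by positivity,
    by have := sub_pos.2 hab; positivity, fun θ hθ hθ1 ε t hε ht ξ hξ => ?_⟩
  set u := 4 * Real.pi ^ 2 * ‖ξ‖ ^ 2 * t with hu
  have hu0 : 0 ≤ u := by positivity
  have hξ' : 0 < |ξ 0| := abs_pos.2 hξ
  have habs : |4 * Real.pi ^ 2 * b * ‖ξ‖ ^ 2| = 4 * Real.pi ^ 2 * |b| * ‖ξ‖ ^ 2 := by
    rw [abs_mul, abs_mul, abs_of_nonneg (by positivity : (0 : ℝ) ≤ 4 * Real.pi ^ 2),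
      abs_of_nonneg (by positivity : (0 : ℝ) ≤ ‖ξ‖ ^ 2)]
  have hκ : |2 * Real.pi * ξ 0 / ε| = 2 * Real.pi * |ξ 0| / ε := by
    rw [abs_div, abs_mul, abs_of_pos hε, abs_of_pos Real.two_pi_pos]
  have hX : |4 * Real.pi ^ 2 * b * ‖ξ‖ ^ 2| / |2 * Real.pi * ξ 0 / ε| *
      (1 + t * |4 * Real.pi ^ 2 * b * ‖ξ‖ ^ 2|) ≤ (|b| * u * (1 + |b| * u)) * (t⁻¹ * ε * |ξ 0|⁻¹) := by
    rw [habs, hκ, hu]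
    have : 4 * Real.pi ^ 2 * |b| * ‖ξ‖ ^ 2 / (2 * Real.pi * |ξ 0| / ε) *
        (1 + t * (4 * Real.pi ^ 2 * |b| * ‖ξ‖ ^ 2)) = (2 * Real.pi)⁻¹ *
        ((|b| * (4 * Real.pi ^ 2 * ‖ξ‖ ^ 2 * t) * (1 + |b| * (4 * Real.pi ^ 2 * ‖ξ‖ ^ 2 * t)) *
          (t⁻¹ * ε * |ξ 0|⁻¹))) := by field_simp
    rw [this]
    refine mul_le_of_le_one_left (by positivity) (inv_le_one_of_one_le₀ ?_)
    linarith [Real.pi_gt_three]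
  have h1 := h θ hθ hθ1 u hu0
  have hexp : -(4 * Real.pi ^ 2 * a * ‖ξ‖ ^ 2 - |4 * Real.pi ^ 2 * b * ‖ξ‖ ^ 2|) * t =
      -(a - |b|) * u := by rw [habs, hu]; ring
  have hexp2 : -((a - |b|) / 2) * u = -(2 * Real.pi ^ 2 * (a - |b|) * t) * ‖ξ‖ ^ 2 := by
    rw [hu]; ring
  unfold averagingWeight
  rw [hexp]
  calc _ ≤ 2 * Real.exp (-(a - |b|) * u) *
        ((|b| * u * (1 + |b| * u)) * (t⁻¹ * ε * |ξ 0|⁻¹)) ^ θ := by gcongr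
    _ = 2 * (Real.exp (-(a - |b|) * u) * (|b| * u * (1 + |b| * u)) ^ θ) *
        (t ^ (-θ) * ε ^ θ * |ξ 0| ^ (-θ)) := by
        rw [Real.mul_rpow (x := |b| * u * (1 + |b| * u)) (by positivity) (by positivity),
          Real.mul_rpow (x := t⁻¹ * ε) (by positivity) (by positivity),
          Real.mul_rpow (x := t⁻¹) (by positivity) (by positivity), Real.inv_rpow ht.le,
          Real.inv_rpow hξ'.le, Real.rpow_neg ht.le, Real.rpow_neg hξ'.le]
        ring
    _ ≤ 2 * (K * Real.exp (-((a - |b|) / 2) * u)) * (t ^ (-θ) * ε ^ θ * |ξ 0| ^ (-θ)) := by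
        gcongr
    _ = _ := by rw [hexp2]; ring

theorem averagingWeight_nonneg {a b ε θ t : ℝ} (ht : 0 ≤ t) (ξ : Rn n) :
    0 ≤ averagingWeight a b ε θ t ξ := by
  unfold averagingWeight; positivity

theorem measurable_averagingWeight {a b ε θ t : ℝ} :
    Measurable (averagingWeight a b ε θ t : Rn n → ℝ) := by
  unfold averagingWeight
  have h : Measurable fun ξ : Rn n => ξ 0 := (EuclideanSpace.proj (0 : Fin n)).continuous.measurable
  simp only [← Real.norm_eq_abs]
  fun_prop

/-- Both `t^{-θ}` and the Gaussian decrease in `t`, so the majorant at `t₀` serves all later times.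
-/
theorem integral_averagingWeight_le {a b : ℝ} (hab : |b| < a) {θ : ℝ} (hθ : 0 < θ) (hθ1 : θ < 1)
    {t₀ : ℝ} (ht₀ : 0 < t₀) :
    ∃ C : ℝ, 0 < C ∧ ∀ ε t : ℝ, 0 < ε → t₀ ≤ t →
      Integrable (averagingWeight a b ε θ t : Rn n → ℝ) ∧
        ∫ ξ : Rn n, averagingWeight a b ε θ t ξ ≤ C * ε ^ θ := by
  obtain ⟨K, c, hK, hc, h⟩ := averagingWeight_le (n := n) hab
  have hint := integrable_exp_neg_mul_normSq_mul_abs_rpow (n := n) (b := c * t₀) (by positivity) hθ1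
  set I := ∫ ξ : Rn n, Real.exp (-(c * t₀) * ‖ξ‖ ^ 2) * |ξ 0| ^ (-θ) with hI
  have hI0 : 0 ≤ I := integral_nonneg fun ξ => by positivity
  -- `I + 1` in place of `I` makes the constant visibly positive.
  refine ⟨K * t₀ ^ (-θ) * (I + 1), by positivity, fun ε t hε ht => ?_⟩
  have ht0 : 0 < t := ht₀.trans_le ht
  have hle : ∀ᵐ ξ : Rn n, averagingWeight a b ε θ t ξ ≤
      K * t₀ ^ (-θ) * ε ^ θ * (Real.exp (-(c * t₀) * ‖ξ‖ ^ 2) * |ξ 0| ^ (-θ)) := by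
    filter_upwards [ae_coord_zero_ne_zero (n := n)] with ξ hξ
    refine (h θ hθ hθ1 ε t hε ht0 ξ hξ).trans ?_
    have : t ^ (-θ) ≤ t₀ ^ (-θ) := Real.rpow_le_rpow_of_nonpos ht₀ ht (by linarith)
    gcongr
  have hint2 := hint.const_mul (K * t₀ ^ (-θ) * ε ^ θ)
  have hw : Integrable (averagingWeight a b ε θ t : Rn n → ℝ) := by
    refine hint2.mono' measurable_averagingWeight.aestronglyMeasurable ?_
    filter_upwards [hle] with ξ hξ
    rwa [Real.norm_of_nonneg (averagingWeight_nonneg ht0.le ξ)]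
  refine ⟨hw, (integral_mono_ae hw hint2 hle).trans ?_⟩
  rw [integral_const_mul, ← hI]
  have h1 : 0 ≤ K * t₀ ^ (-θ) * ε ^ θ := by positivity
  nlinarith

end SymbolWeight

/-! ### Parameter integrals and inverse Fourier transforms of compactly supported families -/

theorem hasDerivAt_integral_of_compactSupport {V G : Type*} [NormedAddCommGroup V]
    [MeasurableSpace V] [BorelSpace V] [NormedAddCommGroup G] [NormedSpace ℝ G]
    {μ : Measure V} [IsFiniteMeasureOnCompacts μ]
    {f f' : ℝ → V → G} {s : Set ℝ} {K : Set V} (hs : IsOpen s) (hK : IsCompact K)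
    (hf : ContinuousOn (Function.uncurry f) (s ×ˢ univ))
    (hf' : ContinuousOn (Function.uncurry f') (s ×ˢ univ))
    (h0 : ∀ r ∈ s, ∀ x ∉ K, f r x = 0) (h0' : ∀ r ∈ s, ∀ x ∉ K, f' r x = 0)
    (hd : ∀ r ∈ s, ∀ x, HasDerivAt (fun r => f r x) (f' r x) r) {r : ℝ} (hr : r ∈ s) :
    HasDerivAt (fun r => ∫ x, f r x ∂μ) (∫ x, f' r x ∂μ) r := by
  obtain ⟨δ, hδ, hball⟩ := Metric.nhds_basis_closedBall.mem_iff.1 (hs.mem_nhds hr)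
  have hcont : ∀ {f : ℝ → V → G}, ContinuousOn (Function.uncurry f) (s ×ˢ univ) →
      ∀ r ∈ s, Continuous (f r) := fun {f} hf r hr =>
    (hf.comp_continuous (f := fun x : V => (r, x)) (by fun_prop) fun x => ⟨hr, mem_univ x⟩)
  have hint : ∀ {f : ℝ → V → G}, ContinuousOn (Function.uncurry f) (s ×ˢ univ) →
      (∀ r ∈ s, ∀ x ∉ K, f r x = 0) → ∀ r ∈ s, Integrable (f r) μ := fun {f} hf h0 r hr =>
    (hcont hf r hr).integrable_of_hasCompactSupport (HasCompactSupport.intro hK (h0 r hr))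
  -- The dominating function is a constant on `K`: the derivative is bounded on the compact set of
  -- nearby times and points of `K`.
  obtain ⟨C, hC⟩ := ((isCompact_closedBall r δ).prod hK).exists_bound_of_continuousOn
    (hf'.mono (prod_mono hball (subset_univ K)))
  refine (hasDerivAt_integral_of_dominated_loc_of_deriv_le (s := Metric.closedBall r δ)
    (F' := f') (bound := K.indicator fun _ => C) (Metric.closedBall_mem_nhds r hδ)
    (mem_of_superset (hs.mem_nhds hr) fun r' hr' => (hint hf h0 r' hr').aestronglyMeasurable)
    (hint hf h0 r hr) (hint hf' h0' r hr).aestronglyMeasurable ?_ ?_ ?_).2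
  · refine Eventually.of_forall fun x r' hr' => ?_
    by_cases hx : x ∈ K
    · rw [indicator_of_mem hx]
      exact hC (r', x) ⟨hr', hx⟩
    · rw [indicator_of_notMem hx, h0' r' (hball hr') x hx, norm_zero]
  · exact (integrable_indicator_iff hK.measurableSet).2 (integrableOn_const hK.measure_ne_top)
  · exact Eventually.of_forall fun x r' hr' => hd r' (hball hr') x

section FourierInvSmooth

open FourierTransform Real

variable {V F : Type*} [NormedAddCommGroup V] [InnerProductSpace ℝ V] [FiniteDimensional ℝ V]
  [MeasurableSpace V] [BorelSpace V] [NormedAddCommGroup F] [InnerProductSpace ℂ F]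
  [CompleteSpace F] {f : V → F}

theorem contDiff_fourierInv_of_compactSupport (hf : ContDiff ℝ ∞ f) (hc : HasCompactSupport f) :
    ContDiff ℝ ∞ (𝓕⁻ f) := by
  have h : 𝓕⁻ f = (𝓕⁻ (hc.toSchwartzMap hf) : SchwartzMap V F) :=
    (SchwartzMap.fourierInv_coe (hc.toSchwartzMap hf)).symm
  rw [h]
  exact SchwartzMap.smooth _ ⊤

theorem fderiv_fourierInv_apply (hf : ContDiff ℝ ∞ f) (hc : HasCompactSupport f) (x v : V) :
    fderiv ℝ (𝓕⁻ f) x v = 𝓕⁻ (fun ξ => (2 * π * Complex.I * (inner ℝ ξ v : ℝ) : ℂ) • f ξ) x := by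
  have h : 𝓕⁻ f = (𝓕⁻ (hc.toSchwartzMap hf) : SchwartzMap V F) :=
    (SchwartzMap.fourierInv_coe (hc.toSchwartzMap hf)).symm
  have ht : (inner ℝ · v : V → ℝ).HasTemperateGrowth := by fun_prop
  rw [h, ← SchwartzMap.lineDerivOp_apply_eq_fderiv, SchwartzMap.lineDerivOp_fourierInv_eq,
    SchwartzMap.fourierInv_coe]
  refine congrArg (fun g : V → F => 𝓕⁻ g x) (funext fun ξ => ?_)
  simp only [_root_.smul_apply, SchwartzMap.smulLeftCLM_apply_apply ht,
    HasCompactSupport.toSchwartzMap_toFun, mul_smul]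
  simp

theorem integrable_norm_sq_fourierInv (hf : ContDiff ℝ ∞ f) (hc : HasCompactSupport f) :
    MemLp (𝓕⁻ f) 2 ∧ ∫ x, ‖𝓕⁻ f x‖ ^ 2 = ∫ ξ, ‖f ξ‖ ^ 2 := by
  have h : 𝓕⁻ f = (𝓕⁻ (hc.toSchwartzMap hf) : SchwartzMap V F) :=
    (SchwartzMap.fourierInv_coe (hc.toSchwartzMap hf)).symm
  rw [h]
  refine ⟨SchwartzMap.memLp _ 2 volume, ?_⟩
  rw [← SchwartzMap.integral_norm_sq_fourier]
  simp

variable {H H' : ℝ → V → F} {K : Set V}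

theorem continuous_fourierInv_family (hK : IsCompact K)
    (hH : Continuous fun p : ℝ × V => H p.1 p.2) (hs : ∀ τ, ∀ ξ ∉ K, H τ ξ = 0) :
    Continuous fun p : ℝ × V => 𝓕⁻ (H p.1) p.2 := by
  simp only [fourierInv_eq']
  rw [← continuousOn_univ]
  refine continuousOn_integral_of_compact_support hK (Continuous.continuousOn ?_) ?_
  · have h1 : Continuous fun q : (ℝ × V) × V => H q.1.1 q.2 :=
      hH.comp (by fun_prop : Continuous fun q : (ℝ × V) × V => (q.1.1, q.2))
    simp only [Function.uncurry_def]
    fun_prop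
  · intro p ξ _ hξ
    rw [hs _ _ hξ, smul_zero]

theorem hasDerivAt_fourierInv_family (hK : IsCompact K)
    (hH : Continuous fun p : ℝ × V => H p.1 p.2) (hs : ∀ τ, ∀ ξ ∉ K, H τ ξ = 0)
    (hH' : Continuous fun p : ℝ × V => H' p.1 p.2) (hs' : ∀ τ, ∀ ξ ∉ K, H' τ ξ = 0)
    (hd : ∀ τ ξ, HasDerivAt (fun r => H r ξ) (H' τ ξ) τ) (τ : ℝ) (x : V) :
    HasDerivAt (fun r => 𝓕⁻ (H r) x) (𝓕⁻ (H' τ) x) τ := by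
  simp only [fourierInv_eq']
  have hcont : ∀ {G : ℝ → V → F}, (Continuous fun p : ℝ × V => G p.1 p.2) → Continuous
      (Function.uncurry fun r v => Complex.exp (↑(2 * π * inner ℝ v x) * Complex.I) • G r v) := by
    intro G hG
    simp only [Function.uncurry_def]
    fun_prop
  exact hasDerivAt_integral_of_compactSupport isOpen_univ hK (hcont hH).continuousOn
    (hcont hH').continuousOn (fun r _ v hv => by rw [hs r v hv, smul_zero])
    (fun r _ v hv => by rw [hs' r v hv, smul_zero]) (fun r _ v => (hd r v).const_smul _)
    (mem_univ τ)

end FourierInvSmooth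

/-! ### Matrix symbol and its exponential -/

section Propagator

variable {n : ℕ} [NeZero n] {F : Type*} [NormedAddCommGroup F] [InnerProductSpace ℂ F]
  [CompleteSpace F]

/-- The Fourier symbol of the operator `A Δ + B ∂₁`. -/
def symbol (A B : F →L[ℂ] F) (ξ : Rn n) : F →L[ℂ] F :=
  (-(4 * Real.pi ^ 2 * ‖ξ‖ ^ 2 : ℝ) : ℂ) • A + (2 * Real.pi * Complex.I * (ξ 0 : ℝ) : ℂ) • B

/-- The Fourier multiplier solving `W_t = A ΔW + B ∂₁W`. -/
def propagator (A B : F →L[ℂ] F) (t : ℝ) (ξ : Rn n) : F →L[ℂ] F :=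
  NormedSpace.exp (t • symbol A B ξ)

variable (A B : F →L[ℂ] F)

theorem contDiff_symbol : ContDiff ℝ ∞ (symbol A B : Rn n → F →L[ℂ] F) := by
  unfold symbol
  have h1 : ContDiff ℝ ∞ fun ξ : Rn n => (-(4 * Real.pi ^ 2 * ‖ξ‖ ^ 2 : ℝ) : ℂ) :=
    (Complex.ofRealCLM.contDiff.comp (contDiff_const.mul (contDiff_norm_sq ℝ))).neg
  have h2 : ContDiff ℝ ∞ fun ξ : Rn n => (2 * Real.pi * Complex.I * (ξ 0 : ℝ) : ℂ) :=
    contDiff_const.mul (Complex.ofRealCLM.contDiff.comp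
      (EuclideanSpace.proj (𝕜 := ℝ) (0 : Fin n)).contDiff)
  exact (h1.smul contDiff_const).add (h2.smul contDiff_const)

theorem contDiff_propagator :
    ContDiff ℝ ∞ fun p : ℝ × Rn n => propagator A B p.1 p.2 := by
  have hexp : ContDiff ℝ ∞ (NormedSpace.exp : (F →L[ℂ] F) → (F →L[ℂ] F)) :=
    contDiff_iff_contDiffAt.2 fun x => (NormedSpace.exp_analytic (𝕂 := ℝ) x).contDiffAt
  exact hexp.comp (contDiff_fst.smul ((contDiff_symbol A B).comp contDiff_snd))

theorem propagator_zero (ξ : Rn n) : propagator A B 0 ξ = 1 := by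
  simp [propagator]

theorem hasDerivAt_propagator (t : ℝ) (ξ : Rn n) :
    HasDerivAt (fun r => propagator A B r ξ) (symbol A B ξ * propagator A B t ξ) t :=
  hasDerivAt_exp_smul_const' (𝕂 := ℝ) (symbol A B ξ) t

theorem hasDerivAt_propagator_apply (t : ℝ) (ξ : Rn n) (z : F) :
    HasDerivAt (fun r => propagator A B r ξ z) (symbol A B ξ (propagator A B t ξ z)) t := by
  have := (ContinuousLinearMap.apply ℂ F z).restrictScalars ℝ |>.hasFDerivAt.comp_hasDerivAt t
    (hasDerivAt_propagator A B t ξ)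
  exact this

variable {A B}

/-- The factor of `A` is real and that of `B` is imaginary, so taking adjoints flips the sign of
`B`: the formal adjoint of `A Δ + B ∂₁` is `A Δ - B ∂₁`. -/
theorem star_symbol (hA : star A = A) (hB : star B = B) (ξ : Rn n) :
    star (symbol A B ξ) = symbol A (-B) ξ := by
  simp only [symbol, star_add, star_smul, hA, hB, smul_neg, ← neg_smul]
  congr 2
  · simp
  · simp

theorem inner_propagator_left (hA : star A = A) (hB : star B = B) (t : ℝ) (ξ : Rn n) (x y : F) :
    inner ℂ (propagator A (-B) t ξ x) y = inner ℂ x (propagator A B t ξ y) := by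
  have : propagator A (-B) t ξ = star (propagator A B t ξ) := by
    simp only [propagator]
    rw [NormedSpace.star_exp, star_smul, star_symbol hA hB, star_trivial]
  rw [this, ContinuousLinearMap.star_eq_adjoint, ContinuousLinearMap.adjoint_inner_left]

end Propagator

/-! ### Green's formula with a cutoff -/

section SpatialIntegrationByParts

variable {n : ℕ} {F : Type*} [NormedAddCommGroup F] [InnerProductSpace ℂ F]
  [CompleteSpace F]

theorem two_le_infty : (2 : ℕ∞ω) ≤ ((⊤ : ℕ∞) : ℕ∞ω) := by
  exact WithTop.coe_le_coe.2 (le_top : (2 : ℕ∞) ≤ ⊤)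

theorem laplacian_eq_sum_fderiv {G : Type*} [NormedAddCommGroup G] [NormedSpace ℝ G]
    {f : Rn n → G} (hf : ContDiff ℝ 2 f) (x : Rn n) :
    Laplacian.laplacian f x = ∑ j, fderiv ℝ (fun y => fderiv ℝ f y (EuclideanSpace.single j 1)) x
      (EuclideanSpace.single j 1) := by
  rw [InnerProductSpace.laplacian_eq_iteratedFDeriv_orthonormalBasis f
    (EuclideanSpace.basisFun (Fin n) ℝ)]
  refine Finset.sum_congr rfl fun j _ => ?_
  have hd : DifferentiableAt ℝ (fderiv ℝ f) x :=
    ((hf.fderiv_right (m := 1) (by norm_num)).differentiable one_ne_zero) x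
  rw [iteratedFDeriv_two_apply, fderiv_clm_apply hd (differentiableAt_const _)]
  simp

theorem ContDiff.fderiv_apply_const {V G : Type*} [NormedAddCommGroup V] [NormedSpace ℝ V]
    [NormedAddCommGroup G] [NormedSpace ℝ G] {f : V → G} {k l : ℕ∞ω} (hf : ContDiff ℝ k f)
    (h : l + 1 ≤ k) (v : V) : ContDiff ℝ l fun y => fderiv ℝ f y v :=
  (hf.fderiv_right h).clm_apply contDiff_const

theorem HasCompactSupport.fderiv_apply_const {V G : Type*} [NormedAddCommGroup V] [NormedSpace ℝ V]
    [NormedAddCommGroup G] [NormedSpace ℝ G] {f : V → G} (hf : HasCompactSupport f) (v : V) :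
    HasCompactSupport fun y => fderiv ℝ f y v :=
  hf.fderiv_apply (𝕜 := ℝ) v

theorem integrable_inner_of_compactSupport {f g : Rn n → F} (hf : Continuous f)
    (hfc : HasCompactSupport f) (hg : Continuous g) :
    Integrable fun x => inner ℂ (f x) (g x) := by
  refine (hf.inner hg).integrable_of_hasCompactSupport (hfc.mono fun x hx => ?_)
  contrapose! hx
  simp only [Function.mem_support, not_not] at hx ⊢
  rw [hx, inner_zero_left]

theorem integral_inner_fderiv_eq_neg {φ W : Rn n → F} (hφ : ContDiff ℝ 1 φ)
    (hc : HasCompactSupport φ) (hW : ContDiff ℝ 1 W) (v : Rn n) :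
    ∫ x, inner ℂ (φ x) (fderiv ℝ W x v) = -∫ x, inner ℂ (fderiv ℝ φ x v) (W x) := by
  have hφ' := hφ.fderiv_apply_const (l := 0) (by norm_num) v
  have hW' := hW.fderiv_apply_const (l := 0) (by norm_num) v
  have hc' := hc.fderiv_apply_const v
  exact integral_bilinear_fderiv_right_eq_neg_left_of_integrable
    (B := (isBoundedBilinearMap_inner (𝕜 := ℂ) (E := F)).toContinuousLinearMap)
    (integrable_inner_of_compactSupport hφ'.continuous hc' hW.continuous) (integrable_inner_of_compactSupport hφ.continuous hc hW'.continuous)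
    (integrable_inner_of_compactSupport hφ.continuous hc hW.continuous)
    (fun x _ => hφ.differentiable one_ne_zero x) (fun x _ => hW.differentiable one_ne_zero x)

theorem integral_inner_laplacian {φ W : Rn n → F} (hφ : ContDiff ℝ 2 φ)
    (hc : HasCompactSupport φ) (hW : ContDiff ℝ 2 W) :
    ∫ x, inner ℂ (φ x) (Laplacian.laplacian W x) =
      ∫ x, inner ℂ (Laplacian.laplacian φ x) (W x) := by
  simp only [laplacian_eq_sum_fderiv hW, laplacian_eq_sum_fderiv hφ, inner_sum, sum_inner]
  have h1 := fun v : Rn n => hφ.fderiv_apply_const (l := 1) (by norm_num) v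
  have h2 := fun v : Rn n => hW.fderiv_apply_const (l := 1) (by norm_num) v
  have h1' := fun v : Rn n => (h1 v).fderiv_apply_const (l := 0) (by norm_num) v
  have h2' := fun v : Rn n => (h2 v).fderiv_apply_const (l := 0) (by norm_num) v
  rw [integral_finsetSum _ fun j _ => integrable_inner_of_compactSupport hφ.continuous hc
      (h2' _).continuous,
    integral_finsetSum _ fun j _ => integrable_inner_of_compactSupport (h1' _).continuous
      ((hc.fderiv_apply_const _).fderiv_apply_const _) hW.continuous]
  refine Finset.sum_congr rfl fun j _ => ?_
  rw [integral_inner_fderiv_eq_neg (hφ.of_le (by norm_num)) hc (h2 _),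
    integral_inner_fderiv_eq_neg (h1 _) (hc.fderiv_apply_const _) (hW.of_le (by norm_num)),
    neg_neg]

theorem fderiv_smul_apply_real {χ : Rn n → ℝ} {ψ : Rn n → F} (hχ : Differentiable ℝ χ)
    (hψ : Differentiable ℝ ψ) (x v : Rn n) :
    fderiv ℝ (fun y => χ y • ψ y) x v = χ x • fderiv ℝ ψ x v + fderiv ℝ χ x v • ψ x := by
  rw [fderiv_fun_smul (hχ x) (hψ x)]
  simp

theorem laplacian_real_smul {χ : Rn n → ℝ} {ψ : Rn n → F} (hχ : ContDiff ℝ 2 χ)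
    (hψ : ContDiff ℝ 2 ψ) (x : Rn n) :
    Laplacian.laplacian (fun y => χ y • ψ y) x = χ x • Laplacian.laplacian ψ x +
      ((2 : ℝ) • ∑ j, fderiv ℝ χ x (EuclideanSpace.single j 1) •
        fderiv ℝ ψ x (EuclideanSpace.single j 1) + Laplacian.laplacian χ x • ψ x) := by
  have dχ := hχ.differentiable two_ne_zero
  have dψ := hψ.differentiable two_ne_zero
  have dχ' := fun v => (hχ.fderiv_apply_const (l := 1) (by norm_num) v).differentiable one_ne_zero
  have dψ' := fun v => (hψ.fderiv_apply_const (l := 1) (by norm_num) v).differentiable one_ne_zero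
  rw [laplacian_eq_sum_fderiv (f := fun y => χ y • ψ y) (hχ.smul hψ), laplacian_eq_sum_fderiv hψ,
    laplacian_eq_sum_fderiv hχ, Finset.smul_sum, Finset.smul_sum, Finset.sum_smul,
    ← Finset.sum_add_distrib, ← Finset.sum_add_distrib]
  refine Finset.sum_congr rfl fun j _ => ?_
  have : (fun y => fderiv ℝ (fun y => χ y • ψ y) y (EuclideanSpace.single j 1)) =
      fun y => χ y • fderiv ℝ ψ y (EuclideanSpace.single j 1) +
        fderiv ℝ χ y (EuclideanSpace.single j 1) • ψ y :=
    funext fun y => fderiv_smul_apply_real dχ dψ y _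
  rw [this, fderiv_fun_add (f := fun y => χ y • fderiv ℝ ψ y (EuclideanSpace.single j 1))
    (g := fun y => fderiv ℝ χ y (EuclideanSpace.single j 1) • ψ y)
    ((dχ.smul (dψ' _)) x) (((dχ' _).smul dψ) x)]
  simp only [_root_.add_apply]
  rw [fderiv_smul_apply_real dχ (dψ' _), fderiv_smul_apply_real (dχ' _) dψ, two_smul]
  abel

theorem continuous_laplacian {G : Type*} [NormedAddCommGroup G] [NormedSpace ℝ G]
    {f : Rn n → G} (hf : ContDiff ℝ 2 f) : Continuous (Laplacian.laplacian f) := by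
  have : Laplacian.laplacian f = fun x => ∑ j, fderiv ℝ
      (fun y => fderiv ℝ f y (EuclideanSpace.single j 1)) x (EuclideanSpace.single j 1) :=
    funext (laplacian_eq_sum_fderiv hf)
  rw [this]
  exact continuous_finsetSum _ fun j _ => ((hf.fderiv_apply_const (l := 1)
    (by norm_num) _).fderiv_apply_const (l := 0) (by norm_num) _).continuous

theorem laplacian_eq_zero_of_notMem_tsupport {G : Type*} [NormedAddCommGroup G] [NormedSpace ℝ G]
    {f : Rn n → G} (hf : ContDiff ℝ 2 f) {x : Rn n} (hx : x ∉ tsupport f) :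
    Laplacian.laplacian f x = 0 := by
  have h2 : ∀ v : Rn n, fderiv ℝ (fun y => fderiv ℝ f y v) x v = 0 := fun v => by
    have h1 : x ∉ tsupport fun y => fderiv ℝ f y v := fun h =>
      hx (tsupport_fderiv_apply_subset ℝ v h)
    rw [fderiv_of_notMem_tsupport ℝ h1, _root_.zero_apply]
  rw [laplacian_eq_sum_fderiv hf]
  exact Finset.sum_eq_zero fun j _ => h2 _

theorem hasCompactSupport_laplacian {G : Type*} [NormedAddCommGroup G] [NormedSpace ℝ G]
    {f : Rn n → G} (hf : ContDiff ℝ 2 f) (hc : HasCompactSupport f) :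
    HasCompactSupport (Laplacian.laplacian f) :=
  HasCompactSupport.intro' hc.isCompact (isClosed_tsupport _) fun _ hx =>
    laplacian_eq_zero_of_notMem_tsupport hf hx

variable [NeZero n]

/-- The commutator of the operator `A Δ - B ∂₁` with the multiplication by `χ`. -/
def cutoffCommutator (A B : F →L[ℂ] F) (χ : Rn n → ℝ) (ψ : Rn n → F) (x : Rn n) : F :=
  A ((2 : ℝ) • ∑ j, fderiv ℝ χ x (EuclideanSpace.single j 1) •
    fderiv ℝ ψ x (EuclideanSpace.single j 1) + Laplacian.laplacian χ x • ψ x) -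
    fderiv ℝ χ x (e1 n) • B (ψ x)

theorem apply_laplacian_sub_fderiv_smul (A B : F →L[ℂ] F) {χ : Rn n → ℝ} {ψ : Rn n → F}
    (hχ : ContDiff ℝ 2 χ) (hψ : ContDiff ℝ 2 ψ) (x : Rn n) :
    A (Laplacian.laplacian (fun x => χ x • ψ x) x) -
        B (fderiv ℝ (fun x => χ x • ψ x) x (e1 n)) =
      χ x • (A (Laplacian.laplacian ψ x) - B (fderiv ℝ ψ x (e1 n))) +
        cutoffCommutator A B χ ψ x := by
  have hr : ∀ (T : F →L[ℂ] F) (c : ℝ) (y : F), T (c • y) = c • T y := fun T c y =>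
    (T.restrictScalars ℝ).map_smul c y
  rw [laplacian_real_smul hχ hψ, fderiv_smul_apply_real
    (hχ.differentiable two_ne_zero) (hψ.differentiable two_ne_zero), cutoffCommutator,
    map_add A, map_add B, hr A (χ x), hr B, hr B, smul_sub]
  abel

theorem continuous_cutoffCommutator (A B : F →L[ℂ] F) {χ : Rn n → ℝ} {ψ : Rn n → F}
    (hχ : ContDiff ℝ 2 χ) (hψ : ContDiff ℝ 2 ψ) : Continuous (cutoffCommutator A B χ ψ) := by
  have h1 := fun v => (hχ.fderiv_apply_const (l := 1) (by norm_num) v).continuous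
  have h2 := fun v => (hψ.fderiv_apply_const (l := 1) (by norm_num) v).continuous
  refine Continuous.sub (A.continuous.comp (Continuous.add (Continuous.const_smul
    (continuous_finsetSum _ fun j _ => (h1 _).smul (h2 _)) _) ?_)) ?_
  · exact (continuous_laplacian hχ).smul hψ.continuous
  · exact (h1 _).smul (B.continuous.comp hψ.continuous)

theorem hasCompactSupport_cutoffCommutator (A B : F →L[ℂ] F) {χ : Rn n → ℝ} (ψ : Rn n → F)
    (hχ : ContDiff ℝ 2 χ) (hc : HasCompactSupport χ) :
    HasCompactSupport (cutoffCommutator A B χ ψ) := by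
  refine HasCompactSupport.intro hc.isCompact fun x hx => ?_
  rw [cutoffCommutator, laplacian_eq_zero_of_notMem_tsupport hχ hx,
    fderiv_of_notMem_tsupport ℝ hx]
  simp

/-- No decay is known for the derivatives of `W`, so all derivatives are moved onto the compactly
supported `χ ψ`. The price is the commutator with `χ`. -/
theorem integral_inner_cutoff {A B : F →L[ℂ] F} (hA : star A = A) (hB : star B = B)
    {χ : Rn n → ℝ} {ψ W : Rn n → F} (hχ : ContDiff ℝ 2 χ) (hc : HasCompactSupport χ)
    (hψ : ContDiff ℝ 2 ψ) (hW : ContDiff ℝ 2 W) :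
    ∫ x, inner ℂ (χ x • ψ x) (A (Laplacian.laplacian W x) + B (fderiv ℝ W x (e1 n))) =
      ∫ x, inner ℂ (χ x • (A (Laplacian.laplacian ψ x) - B (fderiv ℝ ψ x (e1 n))) +
        cutoffCommutator A B χ ψ x) (W x) := by
  have hself : ∀ {T : F →L[ℂ] F}, star T = T → ∀ x y, inner ℂ x (T y) = inner ℂ (T x) y := by
    intro T hT x y
    rw [← ContinuousLinearMap.adjoint_inner_left, ← ContinuousLinearMap.star_eq_adjoint, hT]
  have hφ : ContDiff ℝ 2 fun x => χ x • ψ x := hχ.smul hψ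
  have hφc : HasCompactSupport fun x => χ x • ψ x := hc.smul_right
  have hT : ∀ T : F →L[ℂ] F, ContDiff ℝ 2 fun x => T (χ x • ψ x) := fun T =>
    (T.restrictScalars ℝ).contDiff.comp hφ
  have hTc : ∀ T : F →L[ℂ] F, HasCompactSupport fun x => T (χ x • ψ x) := fun T =>
    hφc.comp_left (g := T) (map_zero T)
  have hTlap : ∀ (T : F →L[ℂ] F) x, Laplacian.laplacian (fun x => T (χ x • ψ x)) x =
      T (Laplacian.laplacian (fun x => χ x • ψ x) x) := fun T x =>
    hφ.contDiffAt.laplacian_CLM_comp_left (l := T.restrictScalars ℝ)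
  have hTd : ∀ (T : F →L[ℂ] F) x v, fderiv ℝ (fun x => T (χ x • ψ x)) x v =
      T (fderiv ℝ (fun x => χ x • ψ x) x v) := fun T x v => by
    have := ((T.restrictScalars ℝ).hasFDerivAt.comp x
      (hφ.differentiable two_ne_zero x).hasFDerivAt).fderiv
    exact congrArg (fun L => L v) this
  have hWd := hW.fderiv_apply_const (l := 1) (by norm_num) (e1 n)
  have hφd := hφ.fderiv_apply_const (l := 1) (by norm_num) (e1 n)
  calc _ = ∫ x, (inner ℂ (A (χ x • ψ x)) (Laplacian.laplacian W x) +
        inner ℂ (B (χ x • ψ x)) (fderiv ℝ W x (e1 n))) := by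
        simp only [inner_add_right, hself hA, hself hB]
    _ = (∫ x, inner ℂ (A (χ x • ψ x)) (Laplacian.laplacian W x)) +
        ∫ x, inner ℂ (B (χ x • ψ x)) (fderiv ℝ W x (e1 n)) :=
        integral_add
          (integrable_inner_of_compactSupport (hT A).continuous (hTc A) (continuous_laplacian hW))
          (integrable_inner_of_compactSupport (hT B).continuous (hTc B) hWd.continuous)
    _ = (∫ x, inner ℂ (A (Laplacian.laplacian (fun x => χ x • ψ x) x)) (W x)) -
        ∫ x, inner ℂ (B (fderiv ℝ (fun x => χ x • ψ x) x (e1 n))) (W x) := by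
        rw [integral_inner_laplacian (hT A) (hTc A) hW, integral_inner_fderiv_eq_neg
          ((hT B).of_le (by norm_num)) (hTc B) (hW.of_le (by norm_num)), sub_eq_add_neg]
        simp only [hTlap, hTd]
    _ = ∫ x, (inner ℂ (A (Laplacian.laplacian (fun x => χ x • ψ x) x)) (W x) -
        inner ℂ (B (fderiv ℝ (fun x => χ x • ψ x) x (e1 n))) (W x)) := by
        refine (integral_sub ?_ ?_).symm
        · exact integrable_inner_of_compactSupport
            (A.continuous.comp (continuous_laplacian hφ))
            ((hasCompactSupport_laplacian hφ hφc).comp_left (g := A) (map_zero A)) hW.continuous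
        · exact integrable_inner_of_compactSupport (B.continuous.comp hφd.continuous)
            ((hφc.fderiv_apply_const _).comp_left (g := B) (map_zero B)) hW.continuous
    _ = _ := by
        simp only [← inner_sub_left, apply_laplacian_sub_fderiv_smul A B hχ hψ]

end SpatialIntegrationByParts

/-! ### Flat exhausting cutoffs -/

section Cutoffs

variable {n : ℕ}

theorem fderiv_comp_smul_apply {V G : Type*} [NormedAddCommGroup V] [NormedSpace ℝ V]
    [NormedAddCommGroup G] [NormedSpace ℝ G] {f : V → G} (hf : Differentiable ℝ f) (c : ℝ)
    (x v : V) : fderiv ℝ (fun y => f (c • y)) x v = c • fderiv ℝ f (c • x) v := by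
  have h : HasFDerivAt (fun y : V => c • y) (c • ContinuousLinearMap.id ℝ V) x :=
    (hasFDerivAt_id x).const_smul c
  have := ((hf (c • x)).hasFDerivAt.comp x h).fderiv
  rw [Function.comp_def] at this
  rw [this]
  simp

/-- Smooth cutoffs that exhaust the space and whose derivatives tend uniformly to zero. -/
theorem exists_cutoff_seq (n : ℕ) : ∃ (C : ℝ) (χ : ℕ → Rn n → ℝ), 0 ≤ C ∧
    (∀ k, ContDiff ℝ ∞ (χ k)) ∧ (∀ k, HasCompactSupport (χ k)) ∧ (∀ k x, |χ k x| ≤ 1) ∧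
    (∀ x, ∀ᶠ k in atTop, χ k x = 1) ∧
    (∀ k x j, |fderiv ℝ (χ k) x (EuclideanSpace.single j 1)| ≤ C / (k + 1)) ∧
    (∀ k x, |Laplacian.laplacian (χ k) x| ≤ C / (k + 1)) := by
  let f : ContDiffBump (0 : Rn n) := ⟨1, 2, one_pos, one_lt_two⟩
  have hf : ContDiff ℝ ∞ f := f.contDiff
  have hf2 : ContDiff ℝ 2 f := f.contDiff
  have hfc : HasCompactSupport f := f.hasCompactSupport
  obtain ⟨C1, hC1⟩ : ∃ C, ∀ x, ‖fderiv ℝ f x‖ ≤ C :=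
    (hf.continuous_fderiv (by simp)).bounded_above_of_compact_support (hfc.fderiv ℝ)
  obtain ⟨C2, hC2⟩ : ∃ C, ∀ x, ‖Laplacian.laplacian (f : Rn n → ℝ) x‖ ≤ C :=
    (continuous_laplacian hf2).bounded_above_of_compact_support (hasCompactSupport_laplacian hf2 hfc)
  have hC10 : 0 ≤ C1 := (norm_nonneg _).trans (hC1 0)
  have hC20 : 0 ≤ C2 := (norm_nonneg _).trans (hC2 0)
  -- The cutoffs are dilates of one bump by the factor `k + 1`. Each derivative gains a factor `c
  -- k`; for the Laplacian the second one is estimated by `1`, so that both bounds have the same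
  -- form.
  let c : ℕ → ℝ := fun k => ((k : ℝ) + 1)⁻¹
  have hc0 : ∀ k, 0 < c k := fun k => by positivity
  have hc1 : ∀ k, c k ≤ 1 := fun k => inv_le_one_of_one_le₀ (by simp)
  have hlin : ∀ k, ContDiff ℝ ∞ fun x : Rn n => c k • x := fun k => by fun_prop
  have hfd : ∀ k (x v : Rn n), fderiv ℝ (fun y => f (c k • y)) x v = c k • fderiv ℝ f (c k • x) v :=
    fun k x v => fderiv_comp_smul_apply (hf2.differentiable two_ne_zero) (c k) x v
  refine ⟨C1 + C2, fun k x => f (c k • x), by positivity, fun k => hf.comp (hlin k), fun k => ?_,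
    fun k x => ?_, fun x => ?_, fun k x j => ?_, fun k x => ?_⟩
  · exact hfc.comp_homeomorph (Homeomorph.smulOfNeZero (c k) (hc0 k).ne')
  · rw [abs_of_nonneg f.nonneg]; exact f.le_one
  · have h : Tendsto (fun k => c k • x) atTop (𝓝 ((0 : ℝ) • x)) := by
      have : Tendsto c atTop (𝓝 0) := by
        simpa [c, one_div] using tendsto_one_div_add_atTop_nhds_zero_nat (𝕜 := ℝ)
      exact this.smul_const x
    rw [zero_smul] at h
    filter_upwards [h (Metric.closedBall_mem_nhds 0 one_pos)] with k hk
    exact f.one_of_mem_closedBall hk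
  · rw [hfd, smul_eq_mul, abs_mul, abs_of_pos (hc0 k), div_eq_inv_mul]
    refine mul_le_mul_of_nonneg_left ?_ (hc0 k).le
    have := (fderiv ℝ f (c k • x)).le_opNorm (EuclideanSpace.single j 1)
    rw [PiLp.norm_single, norm_one, mul_one] at this
    exact this.trans ((hC1 _).trans (by linarith))
  · have h2 : Laplacian.laplacian (fun y => f (c k • y)) x =
        c k * (c k * Laplacian.laplacian (f : Rn n → ℝ) (c k • x)) := by
      rw [laplacian_eq_sum_fderiv (f := fun y => f (c k • y)) (hf2.comp ((hlin k).of_le two_le_infty)),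
        laplacian_eq_sum_fderiv hf2, Finset.mul_sum, Finset.mul_sum]
      refine Finset.sum_congr rfl fun j _ => ?_
      simp only [hfd]
      have hd := (hf2.fderiv_apply_const (l := 1) (by norm_num)
        (EuclideanSpace.single j 1)).differentiable one_ne_zero
      have hd' : Differentiable ℝ fun y : Rn n =>
          fderiv ℝ f (c k • y) (EuclideanSpace.single j 1) :=
        hd.comp ((hlin k).differentiable (by simp))
      rw [fderiv_fun_const_smul (hd' x)]
      simp only [_root_.smul_apply, smul_eq_mul]
      rw [fderiv_comp_smul_apply hd, smul_eq_mul]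
    rw [h2, abs_mul, abs_mul, abs_of_pos (hc0 k), div_eq_inv_mul]
    refine mul_le_mul_of_nonneg_left ?_ (hc0 k).le
    have := hC2 (c k • x)
    rw [Real.norm_eq_abs] at this
    calc c k * |Laplacian.laplacian (f : Rn n → ℝ) (c k • x)| ≤ 1 * C2 :=
          mul_le_mul (hc1 k) this (abs_nonneg _) zero_le_one
      _ ≤ _ := by linarith

end Cutoffs

/-! ### Smallness of the cutoff commutator -/

section Commutator

variable {n : ℕ} [NeZero n] {F : Type*} [NormedAddCommGroup F] [InnerProductSpace ℂ F]
  [CompleteSpace F]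

theorem norm_cutoffCommutator_le (A B : F →L[ℂ] F) {χ : Rn n → ℝ} {ψ : Rn n → F} {δ : ℝ}
    (h1 : ∀ x j, |fderiv ℝ χ x (EuclideanSpace.single j 1)| ≤ δ)
    (h2 : ∀ x, |Laplacian.laplacian χ x| ≤ δ) (x : Rn n) :
    ‖cutoffCommutator A B χ ψ x‖ ≤ δ * (2 * ‖A‖ + ‖B‖) *
      (∑ j, ‖fderiv ℝ ψ x (EuclideanSpace.single j 1)‖ + ‖ψ x‖) := by
  set S := ∑ j, ‖fderiv ℝ ψ x (EuclideanSpace.single j 1)‖ with hS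
  have hS0 : 0 ≤ S := Finset.sum_nonneg fun j _ => norm_nonneg _
  have hδ : 0 ≤ δ := (abs_nonneg _).trans (h2 x)
  have hs : ‖∑ j, fderiv ℝ χ x (EuclideanSpace.single j 1) •
      fderiv ℝ ψ x (EuclideanSpace.single j 1)‖ ≤ δ * S := by
    rw [hS, Finset.mul_sum]
    refine norm_sum_le_of_le _ fun j _ => ?_
    rw [norm_smul]
    exact mul_le_mul_of_nonneg_right (h1 x j) (norm_nonneg _)
  have hA : ‖A ((2 : ℝ) • ∑ j, fderiv ℝ χ x (EuclideanSpace.single j 1) •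
    fderiv ℝ ψ x (EuclideanSpace.single j 1) + Laplacian.laplacian χ x • ψ x)‖ ≤
      ‖A‖ * (2 * (δ * S) + δ * ‖ψ x‖) := by
    refine (A.le_opNorm _).trans (mul_le_mul_of_nonneg_left ?_ (norm_nonneg _))
    refine norm_add_le_of_le ?_ ?_
    · rw [norm_smul, Real.norm_ofNat]
      exact mul_le_mul_of_nonneg_left hs zero_le_two
    · rw [norm_smul]
      exact mul_le_mul_of_nonneg_right (h2 x) (norm_nonneg _)
  have hB : ‖fderiv ℝ χ x (e1 n) • B (ψ x)‖ ≤ δ * (‖B‖ * ‖ψ x‖) := by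
    rw [norm_smul]
    exact mul_le_mul (h1 x 0) (B.le_opNorm _) (norm_nonneg _) hδ
  refine (norm_sub_le_of_le hA hB).trans ?_
  have e1 : 0 ≤ δ * ‖A‖ * ‖ψ x‖ := by positivity
  have e2 : 0 ≤ δ * ‖B‖ * S := by positivity
  nlinarith

theorem integrable_mul_of_memLp_two {V G G' : Type*} [MeasurableSpace V] {μ : Measure V}
    [NormedAddCommGroup G] [NormedAddCommGroup G'] {f : V → G} {g : V → G'}
    (hf : MemLp f 2 μ) (hg : MemLp g 2 μ) {M : ℝ} (hfM : ∫ x, ‖f x‖ ^ 2 ∂μ ≤ M)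
    (hgM : ∫ x, ‖g x‖ ^ 2 ∂μ ≤ M) :
    Integrable (fun x => ‖f x‖ * ‖g x‖) μ ∧ ∫ x, ‖f x‖ * ‖g x‖ ∂μ ≤ 2 * M := by
  have hi : Integrable (fun x => ‖f x‖ * ‖g x‖) μ := hf.norm.integrable_mul hg.norm
  have hf2 : Integrable (fun x => ‖f x‖ ^ 2) μ := hf.integrable_norm_pow two_ne_zero
  have hg2 : Integrable (fun x => ‖g x‖ ^ 2) μ := hg.integrable_norm_pow two_ne_zero
  refine ⟨hi, ?_⟩
  calc _ ≤ ∫ x, (‖f x‖ ^ 2 + ‖g x‖ ^ 2) ∂μ := by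
        refine integral_mono hi (hf2.add hg2) fun x => ?_
        show ‖f x‖ * ‖g x‖ ≤ ‖f x‖ ^ 2 + ‖g x‖ ^ 2
        nlinarith [sq_nonneg (‖f x‖ - ‖g x‖), norm_nonneg (f x), norm_nonneg (g x)]
    _ ≤ _ := by rw [integral_add hf2 hg2]; linarith

/-- Every term of the commutator contains a derivative of `χ`, hence a factor `δ`; what remains is a
product of two square integrable functions. Flat cutoffs therefore make the pairing vanish in the
limit. -/
theorem norm_integral_inner_cutoffCommutator_le (A B : F →L[ℂ] F) {χ : Rn n → ℝ}
    {ψ W : Rn n → F} {δ M : ℝ} (h1 : ∀ x j, |fderiv ℝ χ x (EuclideanSpace.single j 1)| ≤ δ)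
    (h2 : ∀ x, |Laplacian.laplacian χ x| ≤ δ)
    (hψ : MemLp ψ 2) (hψM : ∫ x, ‖ψ x‖ ^ 2 ≤ M)
    (hψ' : ∀ j, MemLp (fun x => fderiv ℝ ψ x (EuclideanSpace.single j 1)) 2)
    (hψM' : ∀ j, ∫ x, ‖fderiv ℝ ψ x (EuclideanSpace.single j 1)‖ ^ 2 ≤ M)
    (hW : MemLp W 2) (hWM : ∫ x, ‖W x‖ ^ 2 ≤ M) :
    ‖∫ x, inner ℂ (cutoffCommutator A B χ ψ x) (W x)‖ ≤
      δ * ((2 * ‖A‖ + ‖B‖) * ((n + 1) * (2 * M))) := by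
  have hδ : 0 ≤ δ := (abs_nonneg _).trans (h2 0)
  have hj := fun j => integrable_mul_of_memLp_two (hψ' j) hW (hψM' j) hWM
  have h0 := integrable_mul_of_memLp_two hψ hW hψM hWM
  have hsum : Integrable fun x =>
      (∑ j, ‖fderiv ℝ ψ x (EuclideanSpace.single j 1)‖ * ‖W x‖ + ‖ψ x‖ * ‖W x‖) :=
    (integrable_finsetSum _ fun j _ => (hj j).1).add h0.1
  calc _ ≤ ∫ x, δ * (2 * ‖A‖ + ‖B‖) *
        (∑ j, ‖fderiv ℝ ψ x (EuclideanSpace.single j 1)‖ * ‖W x‖ + ‖ψ x‖ * ‖W x‖) := by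
        refine norm_integral_le_of_norm_le (hsum.const_mul _) (Eventually.of_forall fun x => ?_)
        refine (norm_inner_le_norm _ _).trans ?_
        rw [← Finset.sum_mul, ← add_mul, ← mul_assoc]
        exact mul_le_mul_of_nonneg_right (norm_cutoffCommutator_le A B h1 h2 x) (norm_nonneg _)
    _ = δ * (2 * ‖A‖ + ‖B‖) * ((∑ j, ∫ x, ‖fderiv ℝ ψ x (EuclideanSpace.single j 1)‖ * ‖W x‖) +
        ∫ x, ‖ψ x‖ * ‖W x‖) := by
        rw [integral_const_mul, integral_add (integrable_finsetSum _ fun j _ => (hj j).1) h0.1,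
          integral_finsetSum _ fun j _ => (hj j).1]
    _ ≤ δ * (2 * ‖A‖ + ‖B‖) * ((∑ _j : Fin n, 2 * M) + 2 * M) := by
        refine mul_le_mul_of_nonneg_left (add_le_add (Finset.sum_le_sum fun j _ => (hj j).2) h0.2)
          (by positivity)
    _ = _ := by simp; ring

end Commutator

/-! ### The differential operator as a Fourier multiplier -/

section SymbolOperator

open FourierTransform Real

variable {n : ℕ} [NeZero n] {F : Type*} [NormedAddCommGroup F] [InnerProductSpace ℂ F]
  [CompleteSpace F]

theorem integrable_phase_smul {V : Type*} [NormedAddCommGroup V] [InnerProductSpace ℝ V]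
    [FiniteDimensional ℝ V] [MeasurableSpace V] [BorelSpace V] {f : V → F}
    (hf : Integrable f) (x : V) :
    Integrable fun v => Complex.exp (↑(2 * π * inner ℝ v x) * Complex.I) • f v := by
  have hc : Continuous fun v : V => Complex.exp (↑(2 * π * inner ℝ v x) * Complex.I) := by fun_prop
  refine hf.norm.mono' (hc.aestronglyMeasurable.smul hf.aestronglyMeasurable)
    (Eventually.of_forall fun v => ?_)
  rw [norm_smul, Complex.norm_exp_ofReal_mul_I, one_mul]

theorem apply_fourierInv {V : Type*} [NormedAddCommGroup V] [InnerProductSpace ℝ V]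
    [FiniteDimensional ℝ V] [MeasurableSpace V] [BorelSpace V] (T : F →L[ℂ] F) {f : V → F}
    (hf : Integrable f) (x : V) : T (𝓕⁻ f x) = 𝓕⁻ (fun ξ => T (f ξ)) x := by
  simp only [fourierInv_eq']
  rw [← ContinuousLinearMap.integral_comp_comm]
  · simp only [map_smul]
  · exact integrable_phase_smul hf x

theorem fourierInv_sub_apply {V : Type*} [NormedAddCommGroup V] [InnerProductSpace ℝ V]
    [FiniteDimensional ℝ V] [MeasurableSpace V] [BorelSpace V] {f g : V → F}
    (hf : Integrable f) (hg : Integrable g) (x : V) :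
    𝓕⁻ (fun ξ => f ξ - g ξ) x = 𝓕⁻ f x - 𝓕⁻ g x := by
  simp only [fourierInv_eq', smul_sub]
  exact integral_sub (integrable_phase_smul hf x) (integrable_phase_smul hg x)

theorem fourierInv_sum_apply {V : Type*} [NormedAddCommGroup V] [InnerProductSpace ℝ V]
    [FiniteDimensional ℝ V] [MeasurableSpace V] [BorelSpace V] {ι : Type*} [Fintype ι]
    {f : ι → V → F} (hf : ∀ i, Integrable (f i)) (x : V) :
    𝓕⁻ (fun ξ => ∑ i, f i ξ) x = ∑ i, 𝓕⁻ (f i) x := by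
  simp only [fourierInv_eq', Finset.smul_sum]
  exact integral_finsetSum _ fun i _ => integrable_phase_smul (hf i) x

theorem contDiff_ofReal_inner_smul {f : Rn n → F} (hf : ContDiff ℝ ∞ f) (v : Rn n) :
    ContDiff ℝ ∞ fun ξ => (2 * π * Complex.I * (inner ℝ ξ v : ℝ) : ℂ) • f ξ := by
  have h : ContDiff ℝ ∞ fun ξ : Rn n => (2 * π * Complex.I * (inner ℝ ξ v : ℝ) : ℂ) :=
    contDiff_const.mul (Complex.ofRealCLM.contDiff.comp (contDiff_id.inner ℝ contDiff_const))
  exact h.smul hf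

theorem apply_laplacian_sub_fderiv_fourierInv (A B : F →L[ℂ] F) {f : Rn n → F}
    (hf : ContDiff ℝ ∞ f) (hc : HasCompactSupport f) (x : Rn n) :
    A (Laplacian.laplacian (𝓕⁻ f : Rn n → F) x) - B (fderiv ℝ (𝓕⁻ f) x (e1 n)) =
      𝓕⁻ (fun ξ => symbol A (-B) ξ (f ξ)) x := by
  have hm := fun v => contDiff_ofReal_inner_smul hf v
  have hmc : ∀ v, HasCompactSupport
      fun ξ => (2 * π * Complex.I * (inner ℝ ξ v : ℝ) : ℂ) • f ξ := fun v => hc.smul_left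
  have hm2 := fun v => contDiff_ofReal_inner_smul (hm v) v
  have hint : ∀ {g : Rn n → F}, ContDiff ℝ ∞ g → HasCompactSupport g → Integrable g :=
    fun hg hgc => hg.continuous.integrable_of_hasCompactSupport hgc
  have hlap : Laplacian.laplacian (𝓕⁻ f : Rn n → F) x =
      𝓕⁻ (fun ξ => (-(4 * π ^ 2 * ‖ξ‖ ^ 2 : ℝ) : ℂ) • f ξ) x := by
    rw [laplacian_eq_sum_fderiv ((contDiff_fourierInv_of_compactSupport hf hc).of_le
      two_le_infty)]
    simp only [fderiv_fourierInv_apply hf hc]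
    have : ∀ j, fderiv ℝ (fun y => 𝓕⁻ (fun ξ => (2 * π * Complex.I *
        (inner ℝ ξ (EuclideanSpace.single j (1 : ℝ)) : ℝ) : ℂ) • f ξ) y) x
        (EuclideanSpace.single j 1) = _ := fun j =>
      fderiv_fourierInv_apply (hm _) (hmc _) x _
    simp only [this]
    rw [← fourierInv_sum_apply fun j => hint (hm2 _) (hmc _).smul_left]
    refine congrArg (fun g : Rn n → F => 𝓕⁻ g x) (funext fun ξ => ?_)
    simp only [smul_smul, ← Finset.sum_smul]
    congr 1
    rw [EuclideanSpace.norm_sq_eq]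
    push_cast
    rw [Finset.mul_sum, ← Finset.sum_neg_distrib]
    refine Finset.sum_congr rfl fun j _ => ?_
    rw [EuclideanSpace.inner_single_right]
    simp only [Real.norm_eq_abs, one_mul, conj_trivial]
    rw [← Complex.ofReal_pow |ξ j|, sq_abs]
    push_cast
    linear_combination (4 * (π : ℂ) ^ 2 * (ξ j : ℂ) ^ 2) * Complex.I_sq
  have hfl : ContDiff ℝ ∞ fun ξ : Rn n => (-(4 * π ^ 2 * ‖ξ‖ ^ 2 : ℝ) : ℂ) • f ξ :=
    ((Complex.ofRealCLM.contDiff.comp (contDiff_const.mul (contDiff_norm_sq ℝ))).neg).smul hf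
  have hAf := hint hfl hc.smul_left
  have hBf := hint (hm (e1 n)) (hmc _)
  rw [hlap, fderiv_fourierInv_apply hf hc, apply_fourierInv A hAf,
    apply_fourierInv B hBf,
    ← fourierInv_sub_apply (A.integrable_comp hAf) (B.integrable_comp hBf)]
  refine congrArg (fun g : Rn n → F => 𝓕⁻ g x) (funext fun ξ => ?_)
  simp [symbol, e1, EuclideanSpace.inner_single_right, sub_eq_add_neg]

end SymbolOperator

/-! ### Pairing with the adjoint problem -/

section Duality

open FourierTransform

variable {n : ℕ} [NeZero n] {F : Type*} [NormedAddCommGroup F] [InnerProductSpace ℂ F]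
  [CompleteSpace F]

/-- `W` is a classical solution of `W_t = A ΔW + B ∂₁W` that is bounded in `L²` locally uniformly
in time. -/
structure IsSystemSolution (A B : F →L[ℂ] F) (W : ℝ → Rn n → F) : Prop where
  continuousOn : ContinuousOn (fun p : ℝ × Rn n => W p.1 p.2) (Ici 0 ×ˢ univ)
  differentiableAt_time : ∀ t, 0 < t → ∀ x, DifferentiableAt ℝ (fun s => W s x) t
  contDiff_space : ∀ t, 0 < t → ContDiff ℝ 2 (W t)
  continuousOn_time :
    ContinuousOn (fun p : ℝ × Rn n => deriv (fun s => W s p.2) p.1) (Ioi 0 ×ˢ univ)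
  eq : ∀ t, 0 < t → ∀ x, deriv (fun s => W s x) t =
    A (Laplacian.laplacian (W t) x) + B (fderiv ℝ (W t) x (e1 n))
  memLp : ∀ t, 0 ≤ t → MemLp (W t) 2
  bounded : ∀ T, ∃ M, ∀ t ∈ Icc 0 T, ∫ x, ‖W t x‖ ^ 2 ≤ M

/-- The Fourier transform of the solution of the dual problem with the data `𝓕⁻ g`. -/
def dualProfile (A B : F →L[ℂ] F) (g : Rn n → F) (τ : ℝ) (ξ : Rn n) : F :=
  propagator A (-B) τ ξ (g ξ)

variable {A B : F →L[ℂ] F} {g : Rn n → F}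

theorem contDiff_dualProfile_uncurry (hg : ContDiff ℝ ∞ g) :
    ContDiff ℝ ∞ fun p : ℝ × Rn n => dualProfile A B g p.1 p.2 := by
  have h := (ContinuousLinearMap.restrictScalarsL ℂ F F ℝ ℝ).contDiff.comp
    (contDiff_propagator (n := n) A (-B))
  exact h.clm_apply (hg.comp contDiff_snd)

theorem contDiff_dualProfile (hg : ContDiff ℝ ∞ g) (τ : ℝ) :
    ContDiff ℝ ∞ (dualProfile A B g τ) :=
  (contDiff_dualProfile_uncurry (A := A) (B := B) hg).comp (contDiff_prodMk_right τ)

theorem dualProfile_eq_zero (τ : ℝ) {ξ : Rn n} (hξ : ξ ∉ tsupport g) :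
    dualProfile A B g τ ξ = 0 := by
  rw [dualProfile, image_eq_zero_of_notMem_tsupport hξ, map_zero]

theorem hasCompactSupport_dualProfile (hc : HasCompactSupport g) (τ : ℝ) :
    HasCompactSupport (dualProfile A B g τ) :=
  HasCompactSupport.intro hc fun _ hξ => dualProfile_eq_zero τ hξ

theorem exists_bound_integral_norm_sq {V G : Type*} [NormedAddCommGroup V] [MeasurableSpace V]
    [BorelSpace V] [NormedAddCommGroup G] {μ : Measure V} [IsFiniteMeasureOnCompacts μ]
    {H : ℝ → V → G} {K : Set V} (hK : IsCompact K)
    (hH : Continuous fun p : ℝ × V => H p.1 p.2) (h0 : ∀ τ, ∀ x ∉ K, H τ x = 0) (a b : ℝ) :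
    ∃ M, ∀ τ ∈ Icc a b, ∫ x, ‖H τ x‖ ^ 2 ∂μ ≤ M := by
  have hcont : ContinuousOn (fun τ => ∫ x, ‖H τ x‖ ^ 2 ∂μ) univ :=
    continuousOn_integral_of_compact_support hK (hH.norm.pow 2).continuousOn
      fun τ x _ hx => by simp [h0 τ x hx]
  obtain ⟨M, hM⟩ := (isCompact_Icc (a := a) (b := b)).bddAbove_image
    (hcont.mono (subset_univ _))
  exact ⟨M, fun τ hτ => hM (mem_image_of_mem _ hτ)⟩

/-- A classical solution is differentiable in time only for `t > 0`. The mean value inequality is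
applied on `[a, t]`, and continuity at `0` permits `a → 0`. -/
theorem norm_sub_le_of_deriv_Ioo {f f' : ℝ → ℂ} {t C : ℝ} (ht : 0 < t)
    (hf : ContinuousOn f (Icc 0 t)) (hd : ∀ r ∈ Ioc 0 t, HasDerivAt f (f' r) r)
    (hC : ∀ r ∈ Ioc 0 t, ‖f' r‖ ≤ C) : ‖f t - f 0‖ ≤ C * t := by
  have hC0 : 0 ≤ C := (norm_nonneg _).trans (hC t ⟨ht, le_rfl⟩)
  have h1 : ∀ a ∈ Ioc 0 t, ‖f t - f a‖ ≤ C * t := fun a ha => by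
    have hsub : ∀ r, r ∈ Icc a t → r ∈ Ioc 0 t := fun r hr => ⟨ha.1.trans_le hr.1, hr.2⟩
    have := norm_image_sub_le_of_norm_deriv_le_segment' (f := f) (f' := f') (C := C)
      (fun r hr => (hd r (hsub r hr)).hasDerivWithinAt)
      (fun r hr => hC r (hsub r (Ico_subset_Icc_self hr))) t ⟨ha.2, le_rfl⟩
    refine this.trans (mul_le_mul_of_nonneg_left ?_ hC0)
    linarith [ha.1]
  have h2 : Tendsto f (𝓝[Ioc 0 t] 0) (𝓝 (f 0)) :=
    (hf 0 ⟨le_rfl, ht.le⟩).mono_left (nhdsWithin_mono _ Ioc_subset_Icc_self)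
  have : (𝓝[Ioc 0 t] (0 : ℝ)).NeBot := by
    rw [nhdsWithin_Ioc_eq_nhdsGT ht]; infer_instance
  exact le_of_tendsto (tendsto_const_nhds.sub h2).norm
    (eventually_of_mem self_mem_nhdsWithin h1)

/-- The solution of the dual problem with the data `𝓕⁻ g`. -/
def dualSolution (A B : F →L[ℂ] F) (g : Rn n → F) (τ : ℝ) : Rn n → F :=
  𝓕⁻ (dualProfile A B g τ)

theorem contDiff_dualSolution (hg : ContDiff ℝ ∞ g) (hc : HasCompactSupport g) (τ : ℝ) :
    ContDiff ℝ 2 (dualSolution A B g τ) :=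
  (contDiff_fourierInv_of_compactSupport (contDiff_dualProfile hg τ)
    (hasCompactSupport_dualProfile hc τ)).of_le two_le_infty

theorem continuous_dualSolution (hg : ContDiff ℝ ∞ g) (hc : HasCompactSupport g) :
    Continuous fun p : ℝ × Rn n => dualSolution A B g p.1 p.2 :=
  continuous_fourierInv_family hc (contDiff_dualProfile_uncurry hg).continuous
    fun τ _ hξ => dualProfile_eq_zero τ hξ

theorem dualSolution_zero : dualSolution A B g 0 = 𝓕⁻ g := by
  have : dualProfile A B g 0 = g := funext fun ξ => by
    rw [dualProfile, propagator_zero]; rfl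
  rw [dualSolution, this]

/-- The time derivative of the dual solution. -/
def dualSolutionDeriv (A B : F →L[ℂ] F) (g : Rn n → F) (τ : ℝ) : Rn n → F :=
  𝓕⁻ fun ξ => symbol A (-B) ξ (dualProfile A B g τ ξ)

theorem continuous_symbol_dualProfile (hg : ContDiff ℝ ∞ g) :
    Continuous fun p : ℝ × Rn n => symbol A (-B) p.2 (dualProfile A B g p.1 p.2) :=
  ((contDiff_symbol A (-B)).continuous.comp continuous_snd).clm_apply
    (contDiff_dualProfile_uncurry hg).continuous

theorem continuous_dualSolutionDeriv (hg : ContDiff ℝ ∞ g) (hc : HasCompactSupport g) :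
    Continuous fun p : ℝ × Rn n => dualSolutionDeriv A B g p.1 p.2 :=
  continuous_fourierInv_family (H := fun τ ξ => symbol A (-B) ξ (dualProfile A B g τ ξ)) hc
    (continuous_symbol_dualProfile hg)
    fun τ _ hξ => by rw [dualProfile_eq_zero τ hξ, map_zero]

theorem hasDerivAt_dualSolution (hg : ContDiff ℝ ∞ g) (hc : HasCompactSupport g) (τ : ℝ)
    (x : Rn n) :
    HasDerivAt (fun r => dualSolution A B g r x) (dualSolutionDeriv A B g τ x) τ :=
  hasDerivAt_fourierInv_family (H' := fun τ ξ => symbol A (-B) ξ (dualProfile A B g τ ξ)) hc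
    (contDiff_dualProfile_uncurry hg).continuous (fun τ _ hξ => dualProfile_eq_zero τ hξ)
    (continuous_symbol_dualProfile hg)
    (fun τ _ hξ => by rw [dualProfile_eq_zero τ hξ, map_zero])
    (fun τ ξ => hasDerivAt_propagator_apply A (-B) τ ξ (g ξ)) τ x

theorem dualSolutionDeriv_eq (hg : ContDiff ℝ ∞ g) (hc : HasCompactSupport g) (τ : ℝ) (x : Rn n) :
    A (Laplacian.laplacian (dualSolution A B g τ) x) - B (fderiv ℝ (dualSolution A B g τ) x (e1 n)) =
      dualSolutionDeriv A B g τ x :=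
  apply_laplacian_sub_fderiv_fourierInv A B (contDiff_dualProfile hg τ)
    (hasCompactSupport_dualProfile hc τ) x

/-- By Plancherel the `L²` norm is that of the profile, which lives on a fixed compact set and
depends continuously on time. -/
theorem dualSolution_bound (hg : ContDiff ℝ ∞ g) (hc : HasCompactSupport g) (t : ℝ) :
    ∃ M, ∀ τ ∈ Icc 0 t, MemLp (dualSolution A B g τ) 2 ∧
      ∫ x, ‖dualSolution A B g τ x‖ ^ 2 ≤ M := by
  obtain ⟨M, hM⟩ := exists_bound_integral_norm_sq (μ := volume) hc
    (contDiff_dualProfile_uncurry (A := A) (B := B) hg).continuous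
    (fun τ _ hξ => dualProfile_eq_zero τ hξ) 0 t
  refine ⟨M, fun τ hτ => ?_⟩
  have h := integrable_norm_sq_fourierInv (contDiff_dualProfile (A := A) (B := B) hg τ)
    (hasCompactSupport_dualProfile hc τ)
  exact ⟨h.1, h.2.trans_le (hM τ hτ)⟩

theorem fderiv_dualSolution_bound (hg : ContDiff ℝ ∞ g) (hc : HasCompactSupport g) (t : ℝ)
    (v : Rn n) : ∃ M, ∀ τ ∈ Icc 0 t, MemLp (fun x => fderiv ℝ (dualSolution A B g τ) x v) 2 ∧
      ∫ x, ‖fderiv ℝ (dualSolution A B g τ) x v‖ ^ 2 ≤ M := by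
  have hcont := (contDiff_dualProfile_uncurry (A := A) (B := B) hg).continuous
  obtain ⟨M, hM⟩ := exists_bound_integral_norm_sq (μ := volume)
    (H := fun τ ξ => (2 * Real.pi * Complex.I * (inner ℝ ξ v : ℝ) : ℂ) • dualProfile A B g τ ξ) hc
    (by fun_prop) (fun τ _ hξ => by rw [dualProfile_eq_zero τ hξ, smul_zero]) 0 t
  refine ⟨M, fun τ hτ => ?_⟩
  have h := integrable_norm_sq_fourierInv
    (contDiff_ofReal_inner_smul (contDiff_dualProfile (A := A) (B := B) hg τ) v)
    (hasCompactSupport_dualProfile hc τ).smul_left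
  have he : (fun x => fderiv ℝ (dualSolution A B g τ) x v) = 𝓕⁻ fun ξ =>
      (2 * Real.pi * Complex.I * (inner ℝ ξ v : ℝ) : ℂ) • dualProfile A B g τ ξ :=
    funext fun x => fderiv_fourierInv_apply (contDiff_dualProfile hg τ)
      (hasCompactSupport_dualProfile hc τ) x v
  refine ⟨he ▸ h.1, ?_⟩
  have h2 : ∫ x, ‖fderiv ℝ (dualSolution A B g τ) x v‖ ^ 2 = _ :=
    congrArg (fun f : Rn n → F => ∫ x, ‖f x‖ ^ 2) he
  rw [h2]
  exact h.2.trans_le (hM τ hτ)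

/-- The pairing of a solution with the cutoff dual solution varies only through the commutator. -/
theorem hasDerivAt_integral_inner_cutoff (hA : star A = A) (hB : star B = B)
    {W : ℝ → Rn n → F} (hW : IsSystemSolution A B W) (hg : ContDiff ℝ ∞ g)
    (hc : HasCompactSupport g) {χ : Rn n → ℝ} (hχ : ContDiff ℝ 2 χ) (hχc : HasCompactSupport χ)
    (t : ℝ) {r : ℝ} (hr : 0 < r) :
    HasDerivAt (fun r => ∫ x, inner ℂ (χ x • dualSolution A B g (t - r) x) (W r x))
      (∫ x, inner ℂ (cutoffCommutator A B χ (dualSolution A B g (t - r)) x) (W r x)) r := by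
  have hχ0 : ∀ x ∉ tsupport χ, χ x = 0 := fun x hx => image_eq_zero_of_notMem_tsupport hx
  have hχΨ : Continuous fun p : ℝ × Rn n => χ p.2 • dualSolution A B g (t - p.1) p.2 :=
    (hχ.continuous.comp continuous_snd).smul ((continuous_dualSolution hg hc).comp
      (by fun_prop : Continuous fun p : ℝ × Rn n => (t - p.1, p.2)))
  have hχΨ' : Continuous fun p : ℝ × Rn n => χ p.2 • -dualSolutionDeriv A B g (t - p.1) p.2 :=
    (hχ.continuous.comp continuous_snd).smul ((continuous_dualSolutionDeriv hg hc).comp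
      (by fun_prop : Continuous fun p : ℝ × Rn n => (t - p.1, p.2))).neg
  have hsubset : Ioi (0 : ℝ) ×ˢ (univ : Set (Rn n)) ⊆ Ici 0 ×ˢ univ :=
    prod_mono Ioi_subset_Ici_self subset_rfl
  have hderiv : HasDerivAt (fun r => ∫ x, inner ℂ (χ x • dualSolution A B g (t - r) x) (W r x))
      (∫ x, (inner ℂ (χ x • dualSolution A B g (t - r) x) (deriv (fun s => W s x) r) +
        inner ℂ (χ x • -dualSolutionDeriv A B g (t - r) x) (W r x))) r := by
    refine hasDerivAt_integral_of_compactSupport isOpen_Ioi hχc ?_ ?_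
      (f' := fun r x => inner ℂ (χ x • dualSolution A B g (t - r) x) (deriv (fun s => W s x) r) +
        inner ℂ (χ x • -dualSolutionDeriv A B g (t - r) x) (W r x))
      (fun r _ x hx => by simp [hχ0 x hx]) (fun r _ x hx => by simp [hχ0 x hx])
      (fun r hr x => ?_) (mem_Ioi.2 hr)
    · exact hχΨ.continuousOn.inner (hW.continuousOn.mono hsubset)
    · exact (hχΨ.continuousOn.inner hW.continuousOn_time).add
        (hχΨ'.continuousOn.inner (hW.continuousOn.mono hsubset))
    · have h1 : HasDerivAt (fun r => dualSolution A B g (t - r) x)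
          (-dualSolutionDeriv A B g (t - r) x) r := by
        have := (hasDerivAt_dualSolution (A := A) (B := B) hg hc (t - r) x).scomp r
          ((hasDerivAt_id r).const_sub t)
        rw [neg_one_smul] at this
        exact this
      exact (h1.const_smul (χ x)).inner ℂ (hW.differentiableAt_time r hr x).hasDerivAt
  refine hderiv.congr_deriv ?_
  have hWc := (hW.contDiff_space r hr).continuous
  have hΨ := contDiff_dualSolution (A := A) (B := B) hg hc (t - r)
  have hWt : Continuous fun x => deriv (fun s => W s x) r :=
    hW.continuousOn_time.comp_continuous (f := fun x : Rn n => (r, x)) (by fun_prop)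
      fun x => ⟨hr, mem_univ x⟩
  have i1 := integrable_inner_of_compactSupport (hχ.continuous.smul hΨ.continuous)
    hχc.smul_right hWt
  have i2 : Integrable fun x => inner ℂ (χ x • -dualSolutionDeriv A B g (t - r) x) (W r x) :=
    integrable_inner_of_compactSupport (hχΨ'.comp (Continuous.prodMk_right r)) hχc.smul_right hWc
  have i3 := integrable_inner_of_compactSupport (continuous_cutoffCommutator A B hχ hΨ)
    (hasCompactSupport_cutoffCommutator A B _ hχ hχc) hWc
  -- Through the equation for `W`, the time derivative of `W` becomes the adjoint operator acting on
  -- the dual solution, plus the commutator. The first part cancels against the time derivative of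
  -- the reversed dual solution.
  have hcut := integral_inner_cutoff hA hB hχ hχc hΨ (hW.contDiff_space r hr)
  simp only [← hW.eq r hr, dualSolutionDeriv_eq hg hc] at hcut
  refine (integral_add i1 i2).trans ?_
  refine (congrArg (· + _) hcut).trans ?_
  have h3 : ∫ x, inner ℂ (χ x • dualSolutionDeriv A B g (t - r) x +
      cutoffCommutator A B χ (dualSolution A B g (t - r)) x) (W r x) =
      (∫ x, -inner ℂ (χ x • -dualSolutionDeriv A B g (t - r) x) (W r x)) +
      ∫ x, inner ℂ (cutoffCommutator A B χ (dualSolution A B g (t - r)) x) (W r x) := by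
    refine Eq.trans ?_ (integral_add i2.neg i3)
    refine integral_congr_ae (Eventually.of_forall fun x => ?_)
    simp only [inner_add_left, smul_neg, inner_neg_left, neg_neg]
  rw [h3, integral_neg]
  ring

/-- The point is that `C` is independent of `χ` and `δ`: it is built from `L²` bounds on `[0, t]`
for `W`, the dual solution and its gradient. -/
theorem norm_integral_inner_cutoff_sub_le (hA : star A = A) (hB : star B = B)
    {W : ℝ → Rn n → F} (hW : IsSystemSolution A B W) (hg : ContDiff ℝ ∞ g)
    (hc : HasCompactSupport g) {t : ℝ} (ht : 0 < t) :
    ∃ C, ∀ (χ : Rn n → ℝ) (δ : ℝ), ContDiff ℝ 2 χ → HasCompactSupport χ →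
      (∀ x j, |fderiv ℝ χ x (EuclideanSpace.single j 1)| ≤ δ) →
      (∀ x, |Laplacian.laplacian χ x| ≤ δ) →
      ‖(∫ x, inner ℂ (χ x • dualSolution A B g (t - t) x) (W t x)) -
        ∫ x, inner ℂ (χ x • dualSolution A B g (t - 0) x) (W 0 x)‖ ≤ δ * C := by
  obtain ⟨M0, hM0⟩ := dualSolution_bound (A := A) (B := B) hg hc t
  choose M1 hM1 using fun j : Fin n => fderiv_dualSolution_bound (A := A) (B := B) hg hc t
    (EuclideanSpace.single j 1)
  obtain ⟨M2, hM2⟩ := hW.bounded t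
  set M := |M0| + ∑ j, |M1 j| + |M2| with hM
  have hM1s : 0 ≤ ∑ j, |M1 j| := Finset.sum_nonneg fun j _ => abs_nonneg _
  have hMle : M0 ≤ M ∧ M2 ≤ M ∧ ∀ j, M1 j ≤ M := by
    refine ⟨?_, ?_, fun j => ?_⟩
    · linarith [le_abs_self M0, abs_nonneg M2]
    · linarith [le_abs_self M2, abs_nonneg M0]
    · have : |M1 j| ≤ ∑ j, |M1 j| := Finset.single_le_sum (f := fun j => |M1 j|)
        (fun j _ => abs_nonneg _) (Finset.mem_univ j)
      linarith [le_abs_self (M1 j), abs_nonneg M0, abs_nonneg M2]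
  refine ⟨(2 * ‖A‖ + ‖B‖) * ((n + 1) * (2 * M)) * t, fun χ δ hχ hχc h1 h2 => ?_⟩
  have hχΨ : Continuous fun p : ℝ × Rn n => χ p.2 • dualSolution A B g (t - p.1) p.2 :=
    (hχ.continuous.comp continuous_snd).smul ((continuous_dualSolution hg hc).comp
      (by fun_prop : Continuous fun p : ℝ × Rn n => (t - p.1, p.2)))
  have hIc : ContinuousOn
      (fun r => ∫ x, inner ℂ (χ x • dualSolution A B g (t - r) x) (W r x)) (Icc 0 t) := by
    refine (continuousOn_integral_of_compact_support (s := Ici 0) hχc ?_ ?_).mono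
      Icc_subset_Ici_self
    · exact hχΨ.continuousOn.inner hW.continuousOn
    · intro r x _ hx
      rw [image_eq_zero_of_notMem_tsupport hx, zero_smul, inner_zero_left]
  rw [← mul_assoc]
  refine norm_sub_le_of_deriv_Ioo ht hIc
    (fun r hr => hasDerivAt_integral_inner_cutoff hA hB hW hg hc hχ hχc t hr.1) fun r hr => ?_
  have htr : t - r ∈ Icc 0 t := ⟨by linarith [hr.2], by linarith [hr.1]⟩
  exact norm_integral_inner_cutoffCommutator_le A B h1 h2 (hM0 _ htr).1
    ((hM0 _ htr).2.trans hMle.1) (fun j => (hM1 j _ htr).1)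
    (fun j => (hM1 j _ htr).2.trans (hMle.2.2 j))
    (hW.memLp r hr.1.le) ((hM2 r ⟨hr.1.le, hr.2⟩).trans hMle.2.1)

/-- The pairing of `W r` with the dual solution at time `t - r` does not depend on `r`; the two
sides are its values at `r = t` and `r = 0`. With cutoffs this holds up to `O(1/(k+1))`, and
dominated convergence removes them. -/
theorem integral_inner_dualSolution (hA : star A = A) (hB : star B = B)
    {W : ℝ → Rn n → F} (hW : IsSystemSolution A B W) (hg : ContDiff ℝ ∞ g)
    (hc : HasCompactSupport g) {t : ℝ} (ht : 0 < t) :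
    ∫ x, inner ℂ (𝓕⁻ g x) (W t x) = ∫ x, inner ℂ (dualSolution A B g t x) (W 0 x) := by
  obtain ⟨C', hC'⟩ := norm_integral_inner_cutoff_sub_le hA hB hW hg hc ht
  obtain ⟨M, hM⟩ := dualSolution_bound (A := A) (B := B) hg hc t
  obtain ⟨C, χ, hC, hχ, hχc, hχ1, hχt, hχd, hχl⟩ := exists_cutoff_seq n
  have hlim : ∀ r ∈ Icc 0 t, Tendsto
      (fun k => ∫ x, inner ℂ (χ k x • dualSolution A B g (t - r) x) (W r x)) atTop
      (𝓝 (∫ x, inner ℂ (dualSolution A B g (t - r) x) (W r x))) := by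
    intro r hr
    have hWc : Continuous (W r) := hW.continuousOn.comp_continuous (f := fun x : Rn n => (r, x))
      (by fun_prop) fun x => ⟨hr.1, mem_univ x⟩
    have hΨ := contDiff_dualSolution (A := A) (B := B) hg hc (t - r)
    have htr : t - r ∈ Icc 0 t := ⟨by linarith [hr.2], by linarith [hr.1]⟩
    refine tendsto_integral_of_dominated_convergence
      (fun x => ‖dualSolution A B g (t - r) x‖ * ‖W r x‖)
      (fun k => ?_) ((hM _ htr).1.norm.integrable_mul (hW.memLp r hr.1).norm) (fun k => ?_) ?_
    · exact (((hχ k).continuous.smul hΨ.continuous).inner hWc).aestronglyMeasurable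
    · refine Eventually.of_forall fun x => (norm_inner_le_norm _ _).trans ?_
      refine mul_le_mul_of_nonneg_right ?_ (norm_nonneg _)
      rw [norm_smul]
      exact mul_le_of_le_one_left (norm_nonneg _) (hχ1 k x)
    · refine Eventually.of_forall fun x => tendsto_const_nhds.congr' ?_
      filter_upwards [hχt x] with k hk
      rw [hk, one_smul]
  have hzero := squeeze_zero (fun k => norm_nonneg _)
    (fun k => hC' (χ k) (C / (k + 1)) ((hχ k).of_le two_le_infty) (hχc k) (hχd k) (hχl k)) (by
      have := (tendsto_one_div_add_atTop_nhds_zero_nat (𝕜 := ℝ)).const_mul C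
      simpa [div_eq_mul_inv] using this.mul_const C')
  have h := tendsto_nhds_unique hzero
    (((hlim t ⟨ht.le, le_rfl⟩).sub (hlim 0 ⟨le_rfl, ht.le⟩)).norm)
  have h' := sub_eq_zero.1 (norm_eq_zero.1 h.symm)
  rwa [sub_self, sub_zero, dualSolution_zero] at h'

end Duality

/-! ### Fourier representation of square integrable solutions -/

section Representation

open FourierTransform

variable {V F : Type*} [NormedAddCommGroup V] [InnerProductSpace ℝ V] [FiniteDimensional ℝ V]
  [MeasurableSpace V] [BorelSpace V] [NormedAddCommGroup F] [InnerProductSpace ℂ F]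
  [CompleteSpace F]

theorem integral_inner_fourier {f g : V → F} (hf : Integrable f) (hg : Integrable g) :
    ∫ ξ, inner ℂ (𝓕 f ξ) (g ξ) = ∫ x, inner ℂ (f x) (𝓕⁻ g x) := by
  have h := VectorFourier.integral_sesq_fourierIntegral_eq_neg_flip (innerSL ℂ (E := F))
    (L := innerₗ V) Real.continuous_fourierChar continuous_inner hf hg
  simp only [innerSL_apply_apply, flip_innerₗ] at h
  exact h

theorem integral_inner_fourierInv {f g : V → F} (hf : Integrable f) (hg : Integrable g) :
    ∫ x, inner ℂ (𝓕⁻ f x) (g x) = ∫ ξ, inner ℂ (f ξ) (𝓕 g ξ) := by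
  have h := integral_inner_fourier hg hf
  have hc : ∀ {u v : V → F}, ∫ x, inner ℂ (u x) (v x) =
      (starRingEnd ℂ) (∫ x, inner ℂ (v x) (u x)) := by
    intro u v
    rw [← integral_conj]
    simp only [inner_conj_symm]
  rw [hc, ← h, ← hc]

theorem ae_eq_of_integral_inner_eq {f g : V → F} (hf : LocallyIntegrable f)
    (hg : LocallyIntegrable g)
    (h : ∀ φ : V → F, ContDiff ℝ ∞ φ → HasCompactSupport φ →
      ∫ x, inner ℂ (φ x) (f x) = ∫ x, inner ℂ (φ x) (g x)) : f =ᵐ[volume] g := by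
  refine ae_eq_of_integral_contDiff_smul_eq hf hg fun φ hφ hφc => ?_
  refine ext_inner_left ℂ fun c => ?_
  have key : ∀ {f : V → F}, LocallyIntegrable f →
      inner ℂ c (∫ x, φ x • f x) = ∫ x, inner ℂ (φ x • c) (f x) := by
    intro f hf
    rw [← integral_inner (hf.integrable_smul_left_of_hasCompactSupport hφ.continuous hφc)]
    refine integral_congr_ae (Eventually.of_forall fun x => ?_)
    simp only [← Complex.coe_smul, inner_smul_left, inner_smul_right, Complex.conj_ofReal]
  rw [key hf, key hg]
  exact h _ (hφ.smul contDiff_const) hφc.smul_right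

theorem continuous_fourierInv {k : V → F} (hk : Integrable k) : Continuous (𝓕⁻ k) :=
  VectorFourier.fourierIntegral_continuous (L := -innerₗ V) Real.continuous_fourierChar
    (by simp only [LinearMap.neg_apply, innerₗ_apply_apply]; fun_prop) hk

/-- A square integrable function whose Fourier transform is, in the weak sense, the integrable
function `k`, is the inverse Fourier integral of `k`. -/
theorem ae_eq_fourierInv_of_integral_inner {w k : V → F} (hw : MemLp w 2) (hk : Integrable k)
    (h : ∀ φ : V → F, ContDiff ℝ ∞ φ → HasCompactSupport φ →
      ∫ x, inner ℂ (𝓕⁻ φ x) (w x) = ∫ x, inner ℂ (φ x) (k x)) : w =ᵐ[volume] 𝓕⁻ k := by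
  set w' : Lp F 2 (volume : Measure V) := hw.toLp w with hw'
  have hLp : ∀ (ψ : SchwartzMap V F) (u : Lp F 2 (volume : Measure V)) (v : V → F),
      u =ᵐ[volume] v → inner ℂ (ψ.toLp 2) u = ∫ x, inner ℂ (ψ x) (v x) := by
    intro ψ u v huv
    rw [L2.inner_def]
    refine integral_congr_ae ?_
    filter_upwards [huv, ψ.coeFn_toLp 2 volume] with x h1 h2
    rw [h1, h2]
  -- The hypothesis identifies the `L²` Fourier transform of `w` with `k`. Afterwards the argument
  -- runs back: unitarity turns the pairing with `w` into one with `k`, where the integral formula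
  -- for `𝓕⁻ k` applies.
  have hFk : (𝓕 w' : Lp F 2 (volume : Measure V)) =ᵐ[volume] k := by
    refine ae_eq_of_integral_inner_eq ((Lp.memLp _).locallyIntegrable one_le_two)
      hk.locallyIntegrable fun φ hφ hφc => ?_
    rw [← h φ hφ hφc]
    have h1 := hLp (hφc.toSchwartzMap hφ) (𝓕 w') _ (EventuallyEq.refl _ _)
    have h2 := hLp (𝓕⁻ (hφc.toSchwartzMap hφ)) w' _ hw.coeFn_toLp
    rw [← SchwartzMap.toLp_fourierInv_eq, ← Lp.inner_fourier_eq, fourier_fourierInv_eq, h1,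
      SchwartzMap.fourierInv_coe] at h2
    exact h2
  refine ae_eq_of_integral_inner_eq (hw.locallyIntegrable one_le_two)
    (continuous_fourierInv hk).locallyIntegrable fun φ hφ hφc => ?_
  have h1 := hLp (hφc.toSchwartzMap hφ) w' _ hw.coeFn_toLp
  have h2 := hLp (𝓕 (hφc.toSchwartzMap hφ)) (𝓕 w') _ hFk
  rw [← SchwartzMap.toLp_fourier_eq, Lp.inner_fourier_eq, h1, SchwartzMap.fourier_coe] at h2
  refine h2.trans (integral_inner_fourier ?_ hk)
  exact hφ.continuous.integrable_of_hasCompactSupport hφc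

variable {n : ℕ} [NeZero n] {A B : F →L[ℂ] F}

/-- Duality gives the pairing of `W t` with `𝓕⁻ g` in terms of `W 0`; the adjoint relation shifts
the propagator from `g` to `𝓕 (W 0)`. The resulting equality almost everywhere holds everywhere,
since both sides are continuous. -/
theorem IsSystemSolution.eq_fourierInv (hA : star A = A) (hB : star B = B)
    {W : ℝ → Rn n → F} (hW : IsSystemSolution A B W) (hW0 : Integrable (W 0)) {t : ℝ} (ht : 0 < t)
    (hk : Integrable fun ξ => propagator A B t ξ (𝓕 (W 0) ξ)) :
    W t = 𝓕⁻ fun ξ => propagator A B t ξ (𝓕 (W 0) ξ) := by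
  refine (Continuous.ae_eq_iff_eq volume (hW.contDiff_space t ht).continuous
    (continuous_fourierInv hk)).1 ?_
  refine ae_eq_fourierInv_of_integral_inner (hW.memLp t ht.le) hk fun g hg hc => ?_
  rw [integral_inner_dualSolution hA hB hW hg hc ht, dualSolution, integral_inner_fourierInv
    ((contDiff_dualProfile hg t).continuous.integrable_of_hasCompactSupport
      (hasCompactSupport_dualProfile hc t)) hW0]
  simp only [dualProfile, inner_propagator_left hA hB]

end Representation

/-! ### From the given problem to a first-order-coupled system -/

section FromLinearSolution

variable {n : ℕ} [NeZero n]

theorem HasWeakDeriv.ae_eq {i : Fin 0 → Fin n} {f g : Rn n → Rn n} (h : HasWeakDeriv i f g) :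
    f =ᵐ[volume] g :=
  ae_eq_of_integral_contDiff_smul_eq h.1 h.2.1 fun φ hφ hφc => by
    simpa using h.2.2 φ hφ hφc

theorem ContinuousInHm.memLp {m : ℕ} {w : ℝ → Rn n → Rn n} (hw : ContinuousInHm m w) {t : ℝ}
    (ht : 0 ≤ t) : MemLp (w t) 2 := by
  -- For the empty multi-index the weak derivative is `w t` itself.
  obtain ⟨g, -, hg⟩ := hw 0 (Nat.zero_le m) Fin.elim0
  exact (memLp_congr_ae (hg t ht).ae_eq).2 (Lp.memLp _)

theorem ContinuousInHm.bounded {m : ℕ} {w : ℝ → Rn n → Rn n} (hw : ContinuousInHm m w) (T : ℝ) :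
    ∃ M, ∀ t ∈ Icc 0 T, ∫ x, ‖w t x‖ ^ 2 ≤ M := by
  obtain ⟨g, hgc, hg⟩ := hw 0 (Nat.zero_le m) Fin.elim0
  obtain ⟨C, hC⟩ := (isCompact_Icc (a := 0) (b := T)).exists_bound_of_continuousOn
    (hgc.mono Icc_subset_Ici_self)
  refine ⟨C ^ 2, fun t ht => ?_⟩
  have h1 : ∫ x, ‖w t x‖ ^ 2 = ∫ x, ‖g t x‖ ^ 2 := by
    refine integral_congr_ae ?_
    filter_upwards [(hg t ht.1).ae_eq] with x hx
    rw [hx]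
  have h2 : ∫ x, ‖g t x‖ ^ 2 = ‖g t‖ ^ 2 := by
    rw [← real_inner_self_eq_norm_sq, L2.inner_def]
    simp only [real_inner_self_eq_norm_sq]
  rw [h1, h2]
  exact pow_le_pow_left₀ (norm_nonneg _) (hC t ht) 2

variable {F : Type*} [NormedAddCommGroup F] [InnerProductSpace ℂ F] [CompleteSpace F]

/-- The relations say that `A` acts as `μ` on the image of `P` and as `ν` on that of `Q`, while `B`
exchanges the two with the factor `ε⁻¹`. This is exactly the structure of the equations for `v` and
`H`. -/
theorem IsLinearSolution.isSystemSolution {m : ℕ} {μ ν ε : ℝ} {v0 H0 : Rn n → Rn n}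
    {v H : ℝ → Rn n → Rn n} (h : IsLinearSolution m μ ν ε v0 H0 v H) {A B : F →L[ℂ] F}
    {P Q : Rn n →L[ℝ] F} (hAP : ∀ u, A (P u) = μ • P u) (hAQ : ∀ u, A (Q u) = ν • Q u)
    (hBP : ∀ u, B (P u) = ε⁻¹ • Q u) (hBQ : ∀ u, B (Q u) = ε⁻¹ • P u) :
    IsSystemSolution A B fun t x => P (v t x) + Q (H t x) where
  continuousOn := (P.continuous.comp_continuousOn h.isClassical_v.continuousOn).add
    (Q.continuous.comp_continuousOn h.isClassical_H.continuousOn)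
  differentiableAt_time t ht x :=
    (P.differentiableAt.comp t (h.isClassical_v.differentiableAt_time t ht x)).add
      (Q.differentiableAt.comp t (h.isClassical_H.differentiableAt_time t ht x))
  contDiff_space t ht := (P.contDiff.comp (h.isClassical_v.contDiff_space t ht)).add
    (Q.contDiff.comp (h.isClassical_H.contDiff_space t ht))
  continuousOn_time := by
    refine ((P.continuous.comp_continuousOn h.isClassical_v.continuousOn_time).add
      (Q.continuous.comp_continuousOn h.isClassical_H.continuousOn_time)).congr fun p hp => ?_
    exact ((P.hasFDerivAt.comp_hasDerivAt _
      (h.isClassical_v.differentiableAt_time p.1 hp.1 p.2).hasDerivAt).add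
      (Q.hasFDerivAt.comp_hasDerivAt _
        (h.isClassical_H.differentiableAt_time p.1 hp.1 p.2).hasDerivAt)).deriv
  eq t ht x := by
    have hv := h.isClassical_v.contDiff_space t ht
    have hH := h.isClassical_H.contDiff_space t ht
    have hPv : ContDiff ℝ 2 fun x => P (v t x) := P.contDiff.comp hv
    have hQH : ContDiff ℝ 2 fun x => Q (H t x) := Q.contDiff.comp hH
    have h1 : deriv (fun s => P (v s x) + Q (H s x)) t =
        P (deriv (fun s => v s x) t) + Q (deriv (fun s => H s x) t) :=
      ((P.hasFDerivAt.comp_hasDerivAt _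
        (h.isClassical_v.differentiableAt_time t ht x).hasDerivAt).add
        (Q.hasFDerivAt.comp_hasDerivAt _
          (h.isClassical_H.differentiableAt_time t ht x).hasDerivAt)).deriv
    have h2 : Laplacian.laplacian (fun x => P (v t x) + Q (H t x)) x =
        P (Laplacian.laplacian (v t) x) + Q (Laplacian.laplacian (H t) x) := by
      have e1 : Laplacian.laplacian (fun x => P (v t x)) x = P (Laplacian.laplacian (v t) x) :=
        hv.contDiffAt.laplacian_CLM_comp_left (l := P)
      have e2 : Laplacian.laplacian (fun x => Q (H t x)) x = Q (Laplacian.laplacian (H t) x) :=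
        hH.contDiffAt.laplacian_CLM_comp_left (l := Q)
      rw [← e1, ← e2]
      exact hPv.contDiffAt.laplacian_add hQH.contDiffAt
    have h3 : fderiv ℝ (fun x => P (v t x) + Q (H t x)) x (e1 n) =
        P (fderiv ℝ (v t) x (e1 n)) + Q (fderiv ℝ (H t) x (e1 n)) := by
      have := ((P.hasFDerivAt.comp x (hv.differentiable two_ne_zero x).hasFDerivAt).add
        (Q.hasFDerivAt.comp x (hH.differentiable two_ne_zero x).hasFDerivAt)).fderiv
      exact congrArg (fun L => L (e1 n)) this
    rw [h1, h2, h3, sub_eq_iff_eq_add.1 (h.eq_v t ht x), sub_eq_iff_eq_add.1 (h.eq_H t ht x)]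
    simp only [map_add, map_smul, hAP, hAQ, hBP, hBQ]
    abel
  memLp t ht := (P.comp_memLp' (h.continuousInHm_v.memLp ht)).add
    (Q.comp_memLp' (h.continuousInHm_H.memLp ht))
  bounded T := by
    obtain ⟨M1, h1⟩ := h.continuousInHm_v.bounded T
    obtain ⟨M2, h2⟩ := h.continuousInHm_H.bounded T
    refine ⟨2 * ‖P‖ ^ 2 * M1 + 2 * ‖Q‖ ^ 2 * M2, fun t ht => ?_⟩
    have i1 : Integrable fun x => ‖v t x‖ ^ 2 :=
      (h.continuousInHm_v.memLp ht.1).integrable_norm_pow two_ne_zero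
    have i2 : Integrable fun x => ‖H t x‖ ^ 2 :=
      (h.continuousInHm_H.memLp ht.1).integrable_norm_pow two_ne_zero
    have i3 : Integrable fun x => ‖P (v t x) + Q (H t x)‖ ^ 2 :=
      ((P.comp_memLp' (h.continuousInHm_v.memLp ht.1)).add
        (Q.comp_memLp' (h.continuousInHm_H.memLp ht.1))).integrable_norm_pow two_ne_zero
    calc _ ≤ ∫ x, (2 * ‖P‖ ^ 2 * ‖v t x‖ ^ 2 + 2 * ‖Q‖ ^ 2 * ‖H t x‖ ^ 2) := by
          refine integral_mono i3 ((i1.const_mul _).add (i2.const_mul _)) fun x => ?_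
          have hn := norm_add_le_of_le (P.le_opNorm (v t x)) (Q.le_opNorm (H t x))
          calc ‖P (v t x) + Q (H t x)‖ ^ 2 ≤ (‖P‖ * ‖v t x‖ + ‖Q‖ * ‖H t x‖) ^ 2 :=
                pow_le_pow_left₀ (norm_nonneg _) hn 2
            _ ≤ 2 * ‖P‖ ^ 2 * ‖v t x‖ ^ 2 + 2 * ‖Q‖ ^ 2 * ‖H t x‖ ^ 2 := by
                nlinarith [sq_nonneg (‖P‖ * ‖v t x‖ - ‖Q‖ * ‖H t x‖)]
      _ = 2 * ‖P‖ ^ 2 * (∫ x, ‖v t x‖ ^ 2) + 2 * ‖Q‖ ^ 2 * ∫ x, ‖H t x‖ ^ 2 := by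
          rw [integral_add (i1.const_mul _) (i2.const_mul _), integral_const_mul,
            integral_const_mul]
      _ ≤ _ := add_le_add (mul_le_mul_of_nonneg_left (h1 t ht) (by positivity))
          (mul_le_mul_of_nonneg_left (h2 t ht) (by positivity))

end FromLinearSolution

/-! ### The explicit 2×2 system and its fast-rotation limit -/

section TwoComponents

variable {n : ℕ} [NeZero n]

/-- The diffusion matrix of the system for `(v + H, v - H)`. -/
def diffusionCLM (a b : ℝ) : EuclideanSpace ℂ (Fin 2) →L[ℂ] EuclideanSpace ℂ (Fin 2) :=
  Matrix.toEuclideanCLM (𝕜 := ℂ) !![(a : ℂ), b; b, a]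

/-- The transport matrix of the system for `(v + H, v - H)`. -/
def transportCLM (c : ℝ) : EuclideanSpace ℂ (Fin 2) →L[ℂ] EuclideanSpace ℂ (Fin 2) :=
  Matrix.toEuclideanCLM (𝕜 := ℂ) !![(c : ℂ), 0; 0, -c]

theorem diffusionCLM_apply (a b : ℝ) (z : EuclideanSpace ℂ (Fin 2)) :
    diffusionCLM a b z 0 = a * z 0 + b * z 1 ∧ diffusionCLM a b z 1 = b * z 0 + a * z 1 := by
  simp [diffusionCLM, Matrix.ofLp_toEuclideanCLM, Matrix.mulVec, dotProduct, Fin.sum_univ_two]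

theorem transportCLM_apply (c : ℝ) (z : EuclideanSpace ℂ (Fin 2)) :
    transportCLM c z 0 = c * z 0 ∧ transportCLM c z 1 = -(c * z 1) := by
  simp [transportCLM, Matrix.ofLp_toEuclideanCLM, Matrix.mulVec, dotProduct, Fin.sum_univ_two]

theorem star_diffusionCLM (a b : ℝ) : star (diffusionCLM a b) = diffusionCLM a b := by
  rw [diffusionCLM, ← map_star]
  congr 1
  ext i j
  fin_cases i <;> fin_cases j <;> simp

theorem star_transportCLM (c : ℝ) : star (transportCLM c) = transportCLM c := by
  rw [transportCLM, ← map_star]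
  congr 1
  ext i j
  fin_cases i <;> fin_cases j <;> simp

theorem symbol_apply (a b c : ℝ) (ξ : Rn n) (z : EuclideanSpace ℂ (Fin 2)) :
    symbol (diffusionCLM a b) (transportCLM c) ξ z 0 =
        (-(4 * Real.pi ^ 2 * a * ‖ξ‖ ^ 2 : ℝ) + (2 * Real.pi * ξ 0 * c : ℝ) * Complex.I) * z 0 -
          (4 * Real.pi ^ 2 * b * ‖ξ‖ ^ 2 : ℝ) * z 1 ∧
      symbol (diffusionCLM a b) (transportCLM c) ξ z 1 =
        (-(4 * Real.pi ^ 2 * a * ‖ξ‖ ^ 2 : ℝ) - (2 * Real.pi * ξ 0 * c : ℝ) * Complex.I) * z 1 -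
          (4 * Real.pi ^ 2 * b * ‖ξ‖ ^ 2 : ℝ) * z 0 := by
  simp only [symbol, _root_.add_apply, _root_.smul_apply, PiLp.add_apply, PiLp.smul_apply,
    smul_eq_mul, (diffusionCLM_apply a b z).1, (diffusionCLM_apply a b z).2,
    (transportCLM_apply c z).1, (transportCLM_apply c z).2]
  constructor <;> (push_cast; ring)

theorem hasDerivAt_propagator_components (a b c : ℝ) (ξ : Rn n) (z : EuclideanSpace ℂ (Fin 2))
    (r : ℝ) :
    HasDerivAt (fun r => propagator (diffusionCLM a b) (transportCLM c) r ξ z 0)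
      ((-(4 * Real.pi ^ 2 * a * ‖ξ‖ ^ 2 : ℝ) + (2 * Real.pi * ξ 0 * c : ℝ) * Complex.I) *
        propagator (diffusionCLM a b) (transportCLM c) r ξ z 0 -
          (4 * Real.pi ^ 2 * b * ‖ξ‖ ^ 2 : ℝ) *
            propagator (diffusionCLM a b) (transportCLM c) r ξ z 1) r ∧
    HasDerivAt (fun r => propagator (diffusionCLM a b) (transportCLM c) r ξ z 1)
      ((-(4 * Real.pi ^ 2 * a * ‖ξ‖ ^ 2 : ℝ) - (2 * Real.pi * ξ 0 * c : ℝ) * Complex.I) *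
        propagator (diffusionCLM a b) (transportCLM c) r ξ z 1 -
          (4 * Real.pi ^ 2 * b * ‖ξ‖ ^ 2 : ℝ) *
            propagator (diffusionCLM a b) (transportCLM c) r ξ z 0) r := by
  have h := hasDerivAt_propagator_apply (diffusionCLM a b) (transportCLM c) r ξ z
  have hs := symbol_apply a b c ξ (propagator (diffusionCLM a b) (transportCLM c) r ξ z)
  rw [← hs.1, ← hs.2]
  have hp : ∀ j : Fin 2, HasDerivAt
      (fun r => propagator (diffusionCLM a b) (transportCLM c) r ξ z j)
      (symbol (diffusionCLM a b) (transportCLM c) ξ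
        (propagator (diffusionCLM a b) (transportCLM c) r ξ z) j) r := fun j =>
    ((EuclideanSpace.proj (𝕜 := ℂ) j).restrictScalars ℝ).hasFDerivAt.comp_hasDerivAt r h
  exact ⟨hp 0, hp 1⟩

theorem norm_apply_le_norm (z : EuclideanSpace ℂ (Fin 2)) (j : Fin 2) : ‖z j‖ ≤ ‖z‖ :=
  PiLp.norm_apply_le z j

theorem norm_le_add (z : EuclideanSpace ℂ (Fin 2)) : ‖z‖ ≤ ‖z 0‖ + ‖z 1‖ := by
  rw [EuclideanSpace.norm_eq, Fin.sum_univ_two]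
  refine Real.sqrt_le_iff.2 ⟨by positivity, ?_⟩
  nlinarith [norm_nonneg (z 0), norm_nonneg (z 1), mul_nonneg (norm_nonneg (z 0)) (norm_nonneg (z 1))]

/-- The damped rotations by which the two components evolve in the limit of rapid rotation. -/
def limitMultiplier (a c t : ℝ) (ξ : Rn n) : ℂ :=
  Complex.exp ((-(4 * Real.pi ^ 2 * a * ‖ξ‖ ^ 2 : ℝ) +
    (2 * Real.pi * ξ 0 * c : ℝ) * Complex.I) * t)

/-- The direction in which the component with index `j` is transported. -/
def waveSign (j : Fin 2) : ℝ := if j = 0 then 1 else -1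

/-- The energy estimate at each frequency; the factor `4` comes from passing from the Euclidean norm
to the sum of the components and back. -/
theorem norm_propagator_le {a b : ℝ} (c : ℝ) {t : ℝ} (ht : 0 ≤ t) (ξ : Rn n)
    (z : EuclideanSpace ℂ (Fin 2)) :
    ‖propagator (diffusionCLM a b) (transportCLM c) t ξ z‖ ≤
      4 * Real.exp (-(4 * Real.pi ^ 2 * (a - |b|) * t) * ‖ξ‖ ^ 2) * ‖z‖ := by
  have h := coupled_ode_norm_le (fun r => (hasDerivAt_propagator_components a b c ξ z r).1)
    (fun r => (hasDerivAt_propagator_components a b c ξ z r).2) ht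
  simp only [propagator_zero] at h
  have hab : -(4 * Real.pi ^ 2 * a * ‖ξ‖ ^ 2 - |4 * Real.pi ^ 2 * b * ‖ξ‖ ^ 2|) * t =
      -(4 * Real.pi ^ 2 * (a - |b|) * t) * ‖ξ‖ ^ 2 := by
    rw [abs_mul, abs_mul, abs_of_nonneg (by positivity : (0 : ℝ) ≤ 4 * Real.pi ^ 2),
      abs_of_nonneg (by positivity : (0 : ℝ) ≤ ‖ξ‖ ^ 2)]
    ring
  rw [hab] at h
  have hz : ‖z 0‖ + ‖z 1‖ ≤ 2 * ‖z‖ := by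
    linarith [norm_apply_le_norm z 0, norm_apply_le_norm z 1]
  have he := Real.exp_pos (-(4 * Real.pi ^ 2 * (a - |b|) * t) * ‖ξ‖ ^ 2)
  have h1 : Real.exp (-(4 * Real.pi ^ 2 * (a - |b|) * t) * ‖ξ‖ ^ 2) * (‖z 0‖ + ‖z 1‖) ≤
      Real.exp (-(4 * Real.pi ^ 2 * (a - |b|) * t) * ‖ξ‖ ^ 2) * (2 * ‖z‖) :=
    mul_le_mul_of_nonneg_left hz he.le
  have h2 := norm_le_add (propagator (diffusionCLM a b) (transportCLM c) t ξ z)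
  have h3 := h.1.trans h1
  have h4 := h.2.trans h1
  linarith

theorem norm_propagator_sub_limitMultiplier_le {a b ε θ : ℝ} (hε : 0 < ε) (hθ : 0 < θ)
    (hθ1 : θ < 1) {t : ℝ} (ht : 0 ≤ t) {ξ : Rn n} (hξ : ξ 0 ≠ 0)
    (z : EuclideanSpace ℂ (Fin 2)) (j : Fin 2) :
    ‖propagator (diffusionCLM a b) (transportCLM ε⁻¹) t ξ z j -
        limitMultiplier a (waveSign j * ε⁻¹) t ξ * z j‖ ≤
      averagingWeight a b ε θ t ξ * (2 * ‖z‖) := by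
  have hκ : 2 * Real.pi * ξ 0 * ε⁻¹ ≠ 0 := by
    have := Real.pi_pos.ne'
    have := hε.ne'
    positivity
  have hz : ‖z 0‖ + ‖z 1‖ ≤ 2 * ‖z‖ := by
    linarith [norm_apply_le_norm z 0, norm_apply_le_norm z 1]
  have hd := hasDerivAt_propagator_components a b ε⁻¹ ξ z
  have hw := averagingWeight_nonneg (a := a) (b := b) (ε := ε) (θ := θ) ht ξ
  have key : ∀ j : Fin 2, ‖propagator (diffusionCLM a b) (transportCLM ε⁻¹) t ξ z j -
        limitMultiplier a (waveSign j * ε⁻¹) t ξ * z j‖ ≤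
      averagingWeight a b ε θ t ξ * (‖z 0‖ + ‖z 1‖) := by
    intro j
    fin_cases j
    · have h := coupled_ode_averaging_rpow hκ hθ hθ1 (fun r => (hd r).1) (fun r => (hd r).2) ht
      simpa [propagator_zero, limitMultiplier, waveSign, averagingWeight, div_eq_mul_inv] using h
    -- The second component takes the role of the first once the components are exchanged, which
    -- reverses the sign of `κ`.
    · have h := coupled_ode_averaging_rpow (κ := -(2 * Real.pi * ξ 0 * ε⁻¹)) (neg_ne_zero.2 hκ) hθ
        hθ1 (y := fun r => propagator (diffusionCLM a b) (transportCLM ε⁻¹) r ξ z 1)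
        (z := fun r => propagator (diffusionCLM a b) (transportCLM ε⁻¹) r ξ z 0) (s := 4 * Real.pi ^ 2 * a * ‖ξ‖ ^ 2) (d := 4 * Real.pi ^ 2 * b * ‖ξ‖ ^ 2)
        (fun r => by
          refine (hd r).2.congr_deriv ?_
          push_cast; ring)
        (fun r => by
          refine (hd r).1.congr_deriv ?_
          push_cast; ring) ht
      rw [add_comm ‖_‖ ‖_‖] at h
      simpa [propagator_zero, limitMultiplier, waveSign, averagingWeight, div_eq_mul_inv] using h
  exact (key j).trans (mul_le_mul_of_nonneg_left hz hw)

end TwoComponents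

/-! ### Heat kernel bound for the limit and error bound for the solution -/

section KernelBound

open FourierTransform

variable {n : ℕ} [NeZero n] {F : Type*} [NormedAddCommGroup F] [InnerProductSpace ℂ F]
  [CompleteSpace F]

theorem integrable_exp_neg_mul_normSq {b : ℝ} (hb : 0 < b) :
    Integrable fun ξ : Rn n => Real.exp (-b * ‖ξ‖ ^ 2) := by
  simpa using integrable_exp_neg_mul_normSq_mul_abs_rpow (n := n) hb zero_lt_one

/-- The heat kernel at time `t` for the diffusivity `a`. -/
def heatKernel (a t : ℝ) (z : Rn n) : ℝ :=
  (4 * Real.pi * a * t)⁻¹ ^ ((n : ℝ) / 2) * Real.exp (-‖z‖ ^ 2 / (4 * a * t))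

theorem heatKernel_nonneg {a t : ℝ} (ha : 0 < a) (ht : 0 < t) (z : Rn n) :
    0 ≤ heatKernel a t z := by
  unfold heatKernel; positivity

theorem heatKernel_le {a t : ℝ} (ha : 0 < a) (ht : 0 < t) (z : Rn n) :
    heatKernel a t z ≤ (4 * Real.pi * a * t)⁻¹ ^ ((n : ℝ) / 2) := by
  unfold heatKernel
  refine mul_le_of_le_one_right (by positivity) (Real.exp_le_one_iff.2 ?_)
  rw [neg_div]
  exact neg_nonpos.2 (by positivity)

theorem continuous_heatKernel (a t : ℝ) : Continuous (heatKernel a t : Rn n → ℝ) := by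
  unfold heatKernel; fun_prop

theorem continuous_limitMultiplier (a c t : ℝ) :
    Continuous (limitMultiplier a c t : Rn n → ℂ) := by
  unfold limitMultiplier
  have : Continuous fun ξ : Rn n => ξ 0 := (EuclideanSpace.proj (𝕜 := ℝ) (0 : Fin n)).continuous
  fun_prop

theorem norm_limitMultiplier (a c t : ℝ) (ξ : Rn n) :
    ‖limitMultiplier a c t ξ‖ = Real.exp (-(4 * Real.pi ^ 2 * a * t) * ‖ξ‖ ^ 2) := by
  rw [limitMultiplier, norm_cexp_neg_add_mul_I]
  ring_nf

/-- The transport phase is linear in `ξ`, so it merely shifts the point at which the transform of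
the Gaussian is evaluated, to `w`. -/
theorem norm_fourier_modulated_limitMultiplier {a t : ℝ} (ha : 0 < a) (ht : 0 < t) (c : ℝ)
    (x y : Rn n) :
    ‖𝓕 (fun ξ : Rn n => Complex.exp (↑(2 * Real.pi * inner ℝ ξ x) * Complex.I) *
      limitMultiplier a c t ξ) y‖ = heatKernel a t (x - y + (c * t) • e1 n) := by
  set b : ℝ := 4 * Real.pi ^ 2 * a * t with hb
  have hb0 : 0 < b := by positivity
  set w : Rn n := x - y + (c * t) • e1 n with hw
  have hint : 𝓕 (fun ξ : Rn n => Complex.exp (↑(2 * Real.pi * inner ℝ ξ x) * Complex.I) *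
      limitMultiplier a c t ξ) y =
      ∫ ξ : Rn n, Complex.exp (-(b : ℂ) * ‖ξ‖ ^ 2 + (2 * Real.pi * Complex.I) * inner ℝ w ξ) := by
    rw [Real.fourier_eq']
    refine integral_congr_ae (Eventually.of_forall fun ξ => ?_)
    simp only [limitMultiplier, smul_eq_mul, ← Complex.exp_add]
    congr 1
    have h0 : inner ℝ (e1 n) ξ = ξ 0 := by
      rw [e1, EuclideanSpace.inner_single_left]; simp
    rw [hw, inner_add_left, inner_sub_left, inner_smul_left, h0, real_inner_comm x, real_inner_comm y,
      hb]
    simp only [conj_trivial]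
    push_cast
    ring
  rw [hint, GaussianFourier.integral_cexp_neg_mul_sq_norm_add (by simpa using hb0), norm_mul,
    heatKernel]
  congr 1
  · have : ((Real.pi : ℂ) / b) = ((4 * Real.pi * a * t)⁻¹ : ℝ) := by
      rw [hb]
      push_cast
      have := Complex.ofReal_ne_zero.2 Real.pi_pos.ne'
      field_simp
    rw [this, Complex.norm_cpow_eq_rpow_re_of_pos (by positivity)]
    congr 1
    simp
  · have : ((2 * Real.pi * Complex.I) ^ 2 * ‖w‖ ^ 2 / (4 * b) : ℂ) =
        ((-‖w‖ ^ 2 / (4 * a * t) : ℝ) : ℂ) := by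
      rw [hb, mul_pow, Complex.I_sq]
      push_cast
      have := Complex.ofReal_ne_zero.2 Real.pi_pos.ne'
      have := Complex.ofReal_ne_zero.2 ha.ne'
      have := Complex.ofReal_ne_zero.2 ht.ne'
      field_simp
      ring
    rw [this, Complex.norm_exp, Complex.ofReal_re]

theorem integrable_limitMultiplier {a t : ℝ} (ha : 0 < a) (ht : 0 < t) (c : ℝ) :
    Integrable (limitMultiplier a c t : Rn n → ℂ) := by
  refine (integrable_exp_neg_mul_normSq (n := n) (b := 4 * Real.pi ^ 2 * a * t)
    (by positivity)).mono' (continuous_limitMultiplier a c t).aestronglyMeasurable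
    (Eventually.of_forall fun ξ => (norm_limitMultiplier a c t ξ).le)

/-- The multiplication formula moves the Fourier transform from `f` to the modulated multiplier,
whose transform is explicit; the result is convolution with a translated heat kernel, up to phases.
-/
theorem norm_fourierInv_limitMultiplier_le {a t : ℝ} (ha : 0 < a) (ht : 0 < t) (c : ℝ)
    {f : Rn n → F} (hf : Integrable f) (x : Rn n) :
    ‖𝓕⁻ (fun ξ => limitMultiplier a c t ξ • 𝓕 f ξ) x‖ ≤
      ∫ y, heatKernel a t (x - y + (c * t) • e1 n) * ‖f y‖ := by
  set g : Rn n → ℂ := fun ξ => Complex.exp (↑(2 * Real.pi * inner ℝ ξ x) * Complex.I) *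
    limitMultiplier a c t ξ with hg
  have hgi : Integrable g := by
    refine (integrable_limitMultiplier ha ht c).norm.mono'
      (Continuous.aestronglyMeasurable ?_) (Eventually.of_forall fun ξ => ?_)
    · have := continuous_limitMultiplier (n := n) a c t
      fun_prop
    · rw [hg, norm_mul, Complex.norm_exp_ofReal_mul_I, one_mul]
  have h := VectorFourier.integral_fourierIntegral_smul_eq_flip (L := innerₗ (Rn n))
    Real.continuous_fourierChar continuous_inner hgi hf
  rw [flip_innerₗ] at h
  have h' : 𝓕⁻ (fun ξ => limitMultiplier a c t ξ • 𝓕 f ξ) x = ∫ y, 𝓕 g y • f y := by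
    rw [Real.fourierInv_eq']
    refine Eq.trans ?_ h.symm
    refine integral_congr_ae (Eventually.of_forall fun ξ => ?_)
    simp only [hg, mul_smul]
    rfl
  rw [h']
  refine (norm_integral_le_integral_norm _).trans_eq ?_
  refine integral_congr_ae (Eventually.of_forall fun y => ?_)
  simp only [norm_smul]
  rw [hg, norm_fourier_modulated_limitMultiplier ha ht]

theorem fourierInv_apply_coord {k : Rn n → EuclideanSpace ℂ (Fin 2)} (hk : Integrable k) (x : Rn n)
    (j : Fin 2) : 𝓕⁻ k x j = 𝓕⁻ (fun ξ => k ξ j) x := by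
  simp only [Real.fourierInv_eq']
  exact ((EuclideanSpace.proj (𝕜 := ℂ) j).integral_comp_comm
    (integrable_phase_smul hk x)).symm

theorem norm_fourier_le {f : Rn n → F} (ξ : Rn n) : ‖𝓕 f ξ‖ ≤ ∫ y, ‖f y‖ :=
  VectorFourier.norm_fourierIntegral_le_integral_norm _ _ _ _ _

theorem continuous_fourier {f : Rn n → F} (hf : Integrable f) : Continuous (𝓕 f) :=
  VectorFourier.fourierIntegral_continuous (L := innerₗ (Rn n)) Real.continuous_fourierChar
    continuous_inner hf

/-- Away from a small averaging error, the solution is bounded by the heat flow of the data,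
transported with the velocity `± 1 / ε`. -/
theorem IsSystemSolution.norm_apply_le {a b ε θ : ℝ} (hab : |b| < a) (hε : 0 < ε) (hθ : 0 < θ)
    (hθ1 : θ < 1) {W : ℝ → Rn n → EuclideanSpace ℂ (Fin 2)}
    (hW : IsSystemSolution (diffusionCLM a b) (transportCLM ε⁻¹) W) (hW0 : Integrable (W 0))
    {t : ℝ} (ht : 0 < t) (hw : Integrable (averagingWeight a b ε θ t : Rn n → ℝ)) (x : Rn n)
    (j : Fin 2) :
    ‖W t x j‖ ≤ (∫ y, heatKernel a t (x - y + (waveSign j * ε⁻¹ * t) • e1 n) * ‖W 0 y‖) +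
      (∫ ξ : Rn n, averagingWeight a b ε θ t ξ) * (2 * ∫ y, ‖W 0 y‖) := by
  have ha : 0 < a := (abs_nonneg b).trans_lt hab
  have hab' : 0 < a - |b| := sub_pos.2 hab
  set N := ∫ y, ‖W 0 y‖ with hN
  have hN0 : 0 ≤ N := integral_nonneg fun y => norm_nonneg _
  have hFc := continuous_fourier hW0
  set k : Rn n → EuclideanSpace ℂ (Fin 2) := fun ξ =>
    propagator (diffusionCLM a b) (transportCLM ε⁻¹) t ξ (𝓕 (W 0) ξ) with hkdef
  have hkc : Continuous k :=
    ((contDiff_propagator _ _).continuous.comp (Continuous.prodMk_right t)).clm_apply hFc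
  -- Here `|b| < a` enters: it leaves a Gaussian against the bounded `𝓕 (W 0)`.
  have hk : Integrable k := by
    refine ((integrable_exp_neg_mul_normSq (n := n) (b := 4 * Real.pi ^ 2 * (a - |b|) * t)
      (by positivity)).mul_const (4 * N)).mono' hkc.aestronglyMeasurable
      (Eventually.of_forall fun ξ => ?_)
    refine (norm_propagator_le ε⁻¹ ht.le ξ _).trans ?_
    have := norm_fourier_le (f := W 0) ξ
    have he := Real.exp_pos (-(4 * Real.pi ^ 2 * (a - |b|) * t) * ‖ξ‖ ^ 2)
    nlinarith
  set l : Rn n → EuclideanSpace ℂ (Fin 2) := fun ξ =>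
    limitMultiplier a (waveSign j * ε⁻¹) t ξ • 𝓕 (W 0) ξ with hldef
  have hl : Integrable l := by
    refine ((integrable_exp_neg_mul_normSq (n := n) (b := 4 * Real.pi ^ 2 * a * t)
      (by positivity)).mul_const N).mono'
      ((continuous_limitMultiplier _ _ _).smul hFc).aestronglyMeasurable
      (Eventually.of_forall fun ξ => ?_)
    rw [hldef, norm_smul, norm_limitMultiplier]
    exact mul_le_mul_of_nonneg_left (norm_fourier_le ξ) (Real.exp_pos _).le
  have hWt : W t = 𝓕⁻ k :=
    hW.eq_fourierInv (star_diffusionCLM a b) (star_transportCLM _) hW0 ht hk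
  -- The inverse transform is bounded by the `L¹` norm in frequency, where averaging applies off the
  -- null set `ξ 0 = 0`.
  have hdiff : ‖𝓕⁻ k x j - 𝓕⁻ l x j‖ ≤ (∫ ξ : Rn n, averagingWeight a b ε θ t ξ) * (2 * N) := by
    have hsub : 𝓕⁻ k x - 𝓕⁻ l x = 𝓕⁻ (fun ξ => k ξ - l ξ) x :=
      (fourierInv_sub_apply hk hl x).symm
    rw [← PiLp.sub_apply, hsub, fourierInv_apply_coord (k := fun ξ => k ξ - l ξ) (hk.sub hl) x j, Real.fourierInv_eq',
      ← integral_mul_const]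
    refine norm_integral_le_of_norm_le (hw.mul_const _) ?_
    filter_upwards [ae_coord_zero_ne_zero (n := n)] with ξ hξ
    rw [norm_smul, Complex.norm_exp_ofReal_mul_I, one_mul]
    refine (norm_propagator_sub_limitMultiplier_le (a := a) (b := b) hε hθ hθ1 ht.le hξ
      (𝓕 (W 0) ξ) j).trans ?_
    exact mul_le_mul_of_nonneg_left (mul_le_mul_of_nonneg_left (norm_fourier_le ξ) zero_le_two)
      (averagingWeight_nonneg ht.le ξ)
  have hlim : ‖𝓕⁻ l x j‖ ≤
      ∫ y, heatKernel a t (x - y + (waveSign j * ε⁻¹ * t) • e1 n) * ‖W 0 y‖ :=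
    (norm_apply_le_norm _ j).trans (norm_fourierInv_limitMultiplier_le ha ht _ hW0 x)
  rw [hWt]
  calc ‖𝓕⁻ k x j‖ = ‖𝓕⁻ l x j + (𝓕⁻ k x j - 𝓕⁻ l x j)‖ := by ring_nf
    _ ≤ _ := norm_add_le_of_le hlim hdiff

end KernelBound

/-! ### Escape of the transported kernel and the two conclusions -/

section FinalEstimate

variable {n : ℕ} [NeZero n]

/-- The kernel is shifted by `t/ε` along `e¹`, against a separation of at most `L`, so `z₀² ≥
t²/(2ε²) - L²`. This yields the factor `exp(-t/(8aε²))`, and `exp(-u) ≤ 1/u` turns it into a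
multiple of `ε²`. -/
theorem heatKernel_transported_le {a t ε L : ℝ} (ha : 0 < a) (ht : 0 < t) (hε : 0 < ε)
    {x y : Rn n} (hL : |x 0 - y 0| ≤ L) (j : Fin 2) :
    heatKernel a t (x - y + (waveSign j * ε⁻¹ * t) • e1 n) ≤
      (4 * Real.pi * a * t)⁻¹ ^ ((n : ℝ) / 2) * (Real.exp (L ^ 2 / (4 * a * t)) *
        (8 * a / t * ε ^ 2)) := by
  set z := x - y + (waveSign j * ε⁻¹ * t) • e1 n with hz
  have hz0 : z 0 = x 0 - y 0 + waveSign j * ε⁻¹ * t := by simp [hz, e1]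
  have hzn : z 0 ^ 2 ≤ ‖z‖ ^ 2 := by
    rw [← sq_abs]
    exact pow_le_pow_left₀ (abs_nonneg _) (PiLp.norm_apply_le z 0) 2
  have hs : waveSign j ^ 2 = 1 := by
    unfold waveSign; split_ifs <;> norm_num
  have hL2 : (x 0 - y 0) ^ 2 ≤ L ^ 2 := by
    rw [← sq_abs]
    exact pow_le_pow_left₀ (abs_nonneg _) hL 2
  have hq : (ε⁻¹ * t) ^ 2 ≤ 2 * z 0 ^ 2 + 2 * L ^ 2 := by
    have h1 : (waveSign j * ε⁻¹ * t) ^ 2 = (ε⁻¹ * t) ^ 2 := by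
      rw [mul_assoc, mul_pow, hs, one_mul]
    have h2 : waveSign j * ε⁻¹ * t = z 0 - (x 0 - y 0) := by rw [hz0]; ring
    rw [← h1, h2]
    nlinarith [sq_nonneg (z 0 + (x 0 - y 0))]
  have hexp : -‖z‖ ^ 2 / (4 * a * t) ≤ L ^ 2 / (4 * a * t) + -(t / (8 * a * ε ^ 2)) := by
    have h3 : t / (8 * a * ε ^ 2) = (ε⁻¹ * t) ^ 2 / 2 / (4 * a * t) := by
      field_simp
      ring
    rw [h3, ← sub_eq_add_neg, ← sub_div]
    exact div_le_div_of_nonneg_right (by linarith) (by positivity)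
  have hinv : Real.exp (-(t / (8 * a * ε ^ 2))) ≤ 8 * a / t * ε ^ 2 := by
    have hu : 0 < t / (8 * a * ε ^ 2) := by positivity
    have h4 : t / (8 * a * ε ^ 2) ≤ Real.exp (t / (8 * a * ε ^ 2)) := by
      linarith [Real.add_one_le_exp (t / (8 * a * ε ^ 2))]
    rw [Real.exp_neg]
    refine (inv_anti₀ hu h4).trans_eq ?_
    field_simp
  refine mul_le_mul_of_nonneg_left ?_ (by positivity)
  refine (Real.exp_le_exp.2 hexp).trans ?_
  rw [Real.exp_add]
  exact mul_le_mul_of_nonneg_left hinv (Real.exp_pos _).le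

/-- The vector `(u_i, σ u_i)`. -/
def coordPair (i : Fin n) (σ : ℂ) : Rn n →L[ℝ] EuclideanSpace ℂ (Fin 2) :=
  (EuclideanSpace.proj (𝕜 := ℝ) i).smulRight (!₂[1, σ] : EuclideanSpace ℂ (Fin 2))

theorem coordPair_apply (i : Fin n) (σ : ℂ) (u : Rn n) :
    coordPair i σ u 0 = u i ∧ coordPair i σ u 1 = u i * σ := by
  simp [coordPair]

/-- The vectors `(1, 1)` and `(1, -1)` are eigenvectors of the diffusion matrix for `a + b = μ` and
`a - b = ν`, and the transport matrix exchanges them up to `ε⁻¹`. -/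
theorem IsLinearSolution.diagonal {m : ℕ} {μ ν ε : ℝ} {v0 H0 : Rn n → Rn n}
    {v H : ℝ → Rn n → Rn n} (h : IsLinearSolution m μ ν ε v0 H0 v H) (i : Fin n) :
    IsSystemSolution (diffusionCLM ((μ + ν) / 2) ((μ - ν) / 2)) (transportCLM ε⁻¹)
      fun t x => coordPair i 1 (v t x) + coordPair i (-1) (H t x) := by
  have hext : ∀ {z w : EuclideanSpace ℂ (Fin 2)}, z 0 = w 0 → z 1 = w 1 → z = w := by
    intro z w h0 h1
    ext k
    fin_cases k
    exacts [h0, h1]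
  refine h.isSystemSolution (fun u => hext ?_ ?_) (fun u => hext ?_ ?_) (fun u => hext ?_ ?_)
    (fun u => hext ?_ ?_) <;>
  simp only [(diffusionCLM_apply _ _ _).1, (diffusionCLM_apply _ _ _).2,
    (transportCLM_apply _ _).1, (transportCLM_apply _ _).2, PiLp.smul_apply,
    (coordPair_apply _ _ _).1, (coordPair_apply _ _ _).2, Complex.real_smul] <;>
  (push_cast; ring)

/-- Each `u i` and `w i` is half the sum or difference of the two components; the factor `n` comes
from summing over coordinates. -/
theorem norm_prod_le_of_coord {u w : Rn n} {β : ℝ}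
    (h : ∀ i (j : Fin 2), ‖(coordPair i 1 u + coordPair i (-1) w) j‖ ≤ β) :
    ‖(u, w)‖ ≤ n * β := by
  have hc : ∀ i, |u i| ≤ β ∧ |w i| ≤ β := by
    intro i
    have h0 := h i 0
    have h1 := h i 1
    rw [PiLp.add_apply, (coordPair_apply _ _ _).1, (coordPair_apply _ _ _).1,
      ← Complex.ofReal_add, Complex.norm_real, Real.norm_eq_abs] at h0
    rw [PiLp.add_apply, (coordPair_apply _ _ _).2, (coordPair_apply _ _ _).2, mul_one, mul_neg_one,
      ← sub_eq_add_neg, ← Complex.ofReal_sub, Complex.norm_real, Real.norm_eq_abs] at h1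
    rw [abs_le] at h0 h1
    constructor <;> rw [abs_le] <;> constructor <;> linarith [h0.1, h0.2, h1.1, h1.2]
  have hsum : ∀ {u : Rn n}, (∀ i, |u i| ≤ β) → ‖u‖ ≤ n * β := by
    intro u hu
    have hd : u = ∑ i, u i • (EuclideanSpace.single i (1 : ℝ) : Rn n) := by
      ext k
      simp [Finset.sum_apply, Pi.single_apply]
    calc ‖u‖ = ‖∑ i, u i • (EuclideanSpace.single i (1 : ℝ) : Rn n)‖ := by rw [← hd]
      _ ≤ ∑ _i : Fin n, β := by
          refine norm_sum_le_of_le _ fun i _ => ?_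
          rw [norm_smul, PiLp.norm_single, norm_one, mul_one]
          exact hu i
      _ = n * β := by simp
  exact max_le (hsum fun i => (hc i).1) (hsum fun i => (hc i).2)

theorem norm_coordPair_add_le (i : Fin n) (u w : Rn n) :
    ‖coordPair i 1 u + coordPair i (-1) w‖ ≤ 4 * ‖(u, w)‖ := by
  have hu : |u i| ≤ ‖(u, w)‖ := (PiLp.norm_apply_le u i).trans (le_max_left _ _)
  have hw : |w i| ≤ ‖(u, w)‖ := (PiLp.norm_apply_le w i).trans (le_max_right _ _)
  refine (norm_le_add _).trans ?_
  have h0 : ‖(coordPair i 1 u + coordPair i (-1) w) 0‖ ≤ |u i| + |w i| := by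
    rw [PiLp.add_apply, (coordPair_apply _ _ _).1, (coordPair_apply _ _ _).1]
    refine (norm_add_le _ _).trans_eq ?_
    simp
  have h1 : ‖(coordPair i 1 u + coordPair i (-1) w) 1‖ ≤ |u i| + |w i| := by
    rw [PiLp.add_apply, (coordPair_apply _ _ _).2, (coordPair_apply _ _ _).2]
    refine (norm_add_le _ _).trans_eq ?_
    simp
  linarith

/-- The solution is bounded by the transported heat flow of the data and the averaging error. -/
theorem IsLinearSolution.norm_le {m : ℕ} {μ ν ε θ : ℝ} {v0 H0 : Rn n → Rn n}
    {v H : ℝ → Rn n → Rn n} (h : IsLinearSolution m μ ν ε v0 H0 v H) (hμ : 0 < μ) (hν : 0 < ν)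
    (hε : 0 < ε) (hθ : 0 < θ) (hθ1 : θ < 1) (hv0 : Integrable v0) (hH0 : Integrable H0) {t : ℝ}
    (ht : 0 < t)
    (hw : Integrable (averagingWeight ((μ + ν) / 2) ((μ - ν) / 2) ε θ t : Rn n → ℝ)) (x : Rn n) :
    ‖(v t x, H t x)‖ ≤ n * (4 * ∑ j : Fin 2,
        (∫ y, heatKernel ((μ + ν) / 2) t (x - y + (waveSign j * ε⁻¹ * t) • e1 n) *
          ‖(v0 y, H0 y)‖) +
      8 * (∫ ξ : Rn n, averagingWeight ((μ + ν) / 2) ((μ - ν) / 2) ε θ t ξ) *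
        ∫ y, ‖(v0 y, H0 y)‖) := by
  set a := (μ + ν) / 2 with ha
  set b := (μ - ν) / 2 with hb
  have hab : |b| < a := by rw [abs_lt]; constructor <;> linarith
  have ha0 : 0 < a := by linarith
  have hU : Integrable fun y => ‖(v0 y, H0 y)‖ := (hv0.prodMk hH0).norm
  set N := ∫ y, ‖(v0 y, H0 y)‖ with hN
  have hWle : ∀ i : Fin n, ∀ᵐ y, ‖coordPair i 1 (v 0 y) + coordPair i (-1) (H 0 y)‖ ≤
      4 * ‖(v0 y, H0 y)‖ := fun i => by
    filter_upwards [h.init_v, h.init_H] with y h1 h2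
    rw [h1, h2]
    exact norm_coordPair_add_le i _ _
  have hW0 : ∀ i : Fin n, Integrable fun y =>
      coordPair i 1 (v 0 y) + coordPair i (-1) (H 0 y) := fun i =>
    ((coordPair i 1).integrable_comp (hv0.congr h.init_v.symm)).add
      ((coordPair i (-1)).integrable_comp (hH0.congr h.init_H.symm))
  have hKi : ∀ (j : Fin 2) {f : Rn n → ℝ}, Integrable f → Integrable fun y =>
      heatKernel a t (x - y + (waveSign j * ε⁻¹ * t) • e1 n) * f y := by
    intro j f hf
    refine hf.bdd_mul (c := (4 * Real.pi * a * t)⁻¹ ^ ((n : ℝ) / 2))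
      (Continuous.aestronglyMeasurable ((continuous_heatKernel a t).comp (by fun_prop)))
      (Eventually.of_forall fun y => ?_)
    rw [Real.norm_of_nonneg (heatKernel_nonneg ha0 ht _)]
    exact heatKernel_le ha0 ht _
  have hK0 : ∀ j : Fin 2, 0 ≤ ∫ y, heatKernel a t (x - y + (waveSign j * ε⁻¹ * t) • e1 n) *
      ‖(v0 y, H0 y)‖ := fun j =>
    integral_nonneg fun y => mul_nonneg (heatKernel_nonneg ha0 ht _) (norm_nonneg _)
  have hI0 : 0 ≤ ∫ ξ : Rn n, averagingWeight a b ε θ t ξ :=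
    integral_nonneg fun ξ => averagingWeight_nonneg ht.le ξ
  refine norm_prod_le_of_coord fun i j => ?_
  refine ((h.diagonal i).norm_apply_le hab hε hθ hθ1 (hW0 i) ht hw x j).trans ?_
  refine add_le_add ?_ ?_
  · calc _ ≤ ∫ y, 4 * (heatKernel a t (x - y + (waveSign j * ε⁻¹ * t) • e1 n) *
          ‖(v0 y, H0 y)‖) := by
          refine integral_mono_ae (hKi j (hW0 i).norm) ((hKi j hU).const_mul 4) ?_
          filter_upwards [hWle i] with y hy
          calc _ ≤ heatKernel a t (x - y + (waveSign j * ε⁻¹ * t) • e1 n) *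
                (4 * ‖(v0 y, H0 y)‖) :=
                mul_le_mul_of_nonneg_left hy (heatKernel_nonneg ha0 ht _)
            _ = _ := by ring
      _ = 4 * ∫ y, heatKernel a t (x - y + (waveSign j * ε⁻¹ * t) • e1 n) *
          ‖(v0 y, H0 y)‖ := integral_const_mul _ _
      _ ≤ _ := mul_le_mul_of_nonneg_left (Finset.single_le_sum (f := fun j : Fin 2 =>
            ∫ y, heatKernel a t (x - y + (waveSign j * ε⁻¹ * t) • e1 n) * ‖(v0 y, H0 y)‖)
            (fun j _ => hK0 j) (Finset.mem_univ j)) (by norm_num)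
  · have : ∫ y, ‖coordPair i 1 (v 0 y) + coordPair i (-1) (H 0 y)‖ ≤ 4 * N := by
      rw [hN, ← integral_const_mul]
      exact integral_mono_ae (hW0 i).norm (hU.const_mul 4) (hWle i)
    calc _ ≤ (∫ ξ : Rn n, averagingWeight a b ε θ t ξ) * (2 * (4 * N)) :=
          mul_le_mul_of_nonneg_left (mul_le_mul_of_nonneg_left this zero_le_two) hI0
      _ = _ := by ring

/-- Dominated convergence: the kernel is bounded by its maximum, and for each fixed `y` its argument
escapes to infinity. -/
theorem tendsto_integral_heatKernel_transported {a t : ℝ} (ha : 0 < a) (ht : 0 < t)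
    {f : Rn n → ℝ} (hf : Integrable f) (x : Rn n) (j : Fin 2) :
    Tendsto (fun ε : ℝ => ∫ y, heatKernel a t (x - y + (waveSign j * ε⁻¹ * t) • e1 n) * f y)
      (𝓝[>] 0) (𝓝 0) := by
  rw [show (0 : ℝ) = ∫ _ : Rn n, (0 : ℝ) by simp]
  refine tendsto_integral_filter_of_dominated_convergence
    (fun y => (4 * Real.pi * a * t)⁻¹ ^ ((n : ℝ) / 2) * ‖f y‖)
    (Eventually.of_forall fun ε => ?_) (Eventually.of_forall fun ε => Eventually.of_forall
      fun y => ?_) (hf.norm.const_mul _) (Eventually.of_forall fun y => ?_)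
  · exact (Continuous.aestronglyMeasurable ((continuous_heatKernel a t).comp
      (by fun_prop))).mul hf.aestronglyMeasurable
  · rw [norm_mul, Real.norm_of_nonneg (heatKernel_nonneg ha ht _)]
    exact mul_le_mul_of_nonneg_right (heatKernel_le ha ht _) (norm_nonneg _)
  · have h1 : Tendsto (fun ε : ℝ => heatKernel a t (x - y + (waveSign j * ε⁻¹ * t) • e1 n))
        (𝓝[>] 0) (𝓝 0) := by
      refine squeeze_zero' (Eventually.of_forall fun ε => heatKernel_nonneg ha ht _)
        (eventually_of_mem self_mem_nhdsWithin fun ε hε =>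
          heatKernel_transported_le ha ht hε (le_refl |x 0 - y 0|) j) ?_
      have hc : Continuous fun ε : ℝ => (4 * Real.pi * a * t)⁻¹ ^ ((n : ℝ) / 2) *
          (Real.exp (|x 0 - y 0| ^ 2 / (4 * a * t)) * (8 * a / t * ε ^ 2)) := by fun_prop
      have := (hc.tendsto 0).mono_left (nhdsWithin_le_nhds (s := Ioi 0))
      simpa using this
    simpa using h1.mul_const (f y)

theorem tendsto_linearSolution_zero {m : ℕ} {μ ν : ℝ} (hμ : 0 < μ) (hν : 0 < ν)
    {v0 H0 : Rn n → Rn n} (hv0 : Integrable v0) (hH0 : Integrable H0)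
    {v H : ℝ → ℝ → Rn n → Rn n}
    (h : ∀ ε, 0 < ε → IsLinearSolution m μ ν ε v0 H0 (v ε) (H ε)) (x : Rn n) {t : ℝ}
    (ht : 0 < t) : Tendsto (fun ε => (v ε t x, H ε t x)) (𝓝[>] 0) (𝓝 0) := by
  have hab : |(μ - ν) / 2| < (μ + ν) / 2 := by rw [abs_lt]; constructor <;> linarith
  -- Any exponent in `(0, 1)` would do, since only convergence is wanted.
  obtain ⟨C, hC, hw⟩ := integral_averagingWeight_le (n := n) hab (θ := 1 / 2) (by norm_num)
    (by norm_num) ht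
  have hN0 : 0 ≤ ∫ y, ‖(v0 y, H0 y)‖ := integral_nonneg fun y => norm_nonneg _
  have hle : ∀ ε : ℝ, 0 < ε → ‖(v ε t x, H ε t x)‖ ≤ n * (4 * ∑ j : Fin 2,
        (∫ y, heatKernel ((μ + ν) / 2) t (x - y + (waveSign j * ε⁻¹ * t) • e1 n) *
          ‖(v0 y, H0 y)‖) +
      8 * (C * ε ^ (1 / 2 : ℝ)) * ∫ y, ‖(v0 y, H0 y)‖) := by
    intro ε hε
    obtain ⟨h1, h2⟩ := hw ε t hε le_rfl
    refine ((h ε hε).norm_le hμ hν hε (by norm_num) (by norm_num) hv0 hH0 ht h1 x).trans ?_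
    gcongr
  refine squeeze_zero_norm' (eventually_of_mem self_mem_nhdsWithin hle) ?_
  have hpow : Tendsto (fun ε : ℝ => ε ^ (1 / 2 : ℝ)) (𝓝[>] 0) (𝓝 0) := by
    have := (Real.continuousAt_rpow_const (0 : ℝ) (1 / 2) (Or.inr (by norm_num))).tendsto
    rw [Real.zero_rpow (by norm_num)] at this
    exact this.mono_left nhdsWithin_le_nhds
  have hheat := tendsto_finsetSum (Finset.univ : Finset (Fin 2)) fun j _ =>
    tendsto_integral_heatKernel_transported (n := n) (a := (μ + ν) / 2) (by linarith) ht
      (hv0.prodMk hH0).norm x j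
  have := ((hheat.const_mul 4).add (((hpow.const_mul C).const_mul 8).mul_const
    (∫ y, ‖(v0 y, H0 y)‖))).const_mul (n : ℝ)
  simpa using this

theorem linearSolution_slab_bound {μ ν : ℝ} (hμ : 0 < μ) (hν : 0 < ν) {θ : ℝ} (hθ : 0 < θ)
    (hθ1 : θ < 1) (R L : ℝ) {t₀ : ℝ} (ht₀ : 0 < t₀) :
    ∃ C : ℝ, 0 < C ∧ ∀ (m : ℕ) (v0 H0 : Rn n → Rn n), Integrable v0 → Integrable H0 →
      (∀ᵐ x, x ∉ slab n R → v0 x = 0 ∧ H0 x = 0) →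
      ∀ ε : ℝ, 0 < ε → ε < 1 → ∀ v H : ℝ → Rn n → Rn n, IsLinearSolution m μ ν ε v0 H0 v H →
        ∀ t : ℝ, t₀ < t → ∀ x ∈ slab n L,
          ‖(v t x, H t x)‖ ≤ C * ε ^ θ * ∫ y, ‖(v0 y, H0 y)‖ := by
  have hab : |(μ - ν) / 2| < (μ + ν) / 2 := by rw [abs_lt]; constructor <;> linarith
  obtain ⟨C, hC, hw⟩ := integral_averagingWeight_le (n := n) hab hθ hθ1 ht₀
  set a := (μ + ν) / 2 with ha
  have ha0 : 0 < a := by linarith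
  -- The kernel bound for the separation `L + R` at time `t₀`; all its factors decrease in `t`.
  set D : ℝ := (4 * Real.pi * a * t₀)⁻¹ ^ ((n : ℝ) / 2) *
    (Real.exp ((L + R) ^ 2 / (4 * a * t₀)) * (8 * a / t₀)) with hD
  have hD0 : 0 < D := by positivity
  have hn : (0 : ℝ) < n := by exact_mod_cast Nat.pos_of_ne_zero (NeZero.ne n)
  refine ⟨n * (8 * D + 8 * C), by positivity,
    fun m v0 H0 hv0 hH0 hsupp ε hε hε1 v H h t ht x hx => ?_⟩
  have ht0 : 0 < t := ht₀.trans ht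
  set N := ∫ y, ‖(v0 y, H0 y)‖ with hN
  have hN0 : 0 ≤ N := integral_nonneg fun y => norm_nonneg _
  obtain ⟨h1, h2⟩ := hw ε t hε ht.le
  have hU : Integrable fun y => ‖(v0 y, H0 y)‖ := (hv0.prodMk hH0).norm
  -- Since `ε < 1`, the kernel contribution of order `ε²` is absorbed by the slower averaging rate.
  have hε2 : ε ^ 2 ≤ ε ^ θ := by
    rw [← Real.rpow_two]
    exact Real.rpow_le_rpow_of_exponent_ge hε hε1.le (by linarith)
  have hheat : ∀ j : Fin 2, ∫ y, heatKernel a t (x - y + (waveSign j * ε⁻¹ * t) • e1 n) *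
      ‖(v0 y, H0 y)‖ ≤ D * ε ^ θ * N := by
    intro j
    rw [hN, ← integral_const_mul]
    refine integral_mono_of_nonneg (Eventually.of_forall fun y =>
      mul_nonneg (heatKernel_nonneg ha0 ht0 _) (norm_nonneg _)) (hU.const_mul _) ?_
    filter_upwards [hsupp] with y hy
    by_cases hyR : y ∈ slab n R
    · refine mul_le_mul_of_nonneg_right ?_ (norm_nonneg _)
      have hxy : |x 0 - y 0| ≤ L + R := by
        have hx' : |x 0| < L := hx
        have hy' : |y 0| < R := hyR
        exact (abs_sub _ _).trans (by linarith)
      refine (heatKernel_transported_le ha0 ht0 hε hxy j).trans ?_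
      calc _ ≤ (4 * Real.pi * a * t₀)⁻¹ ^ ((n : ℝ) / 2) *
            (Real.exp ((L + R) ^ 2 / (4 * a * t₀)) * (8 * a / t₀ * ε ^ θ)) := by gcongr
        _ = _ := by rw [hD]; ring
    · have h0 : (v0 y, H0 y) = 0 := Prod.ext (hy hyR).1 (hy hyR).2
      rw [h0, norm_zero, mul_zero, mul_zero]
  refine (h.norm_le hμ hν hε hθ hθ1 hv0 hH0 ht0 h1 x).trans ?_
  rw [Fin.sum_univ_two]
  calc _ ≤ n * (4 * (D * ε ^ θ * N + D * ε ^ θ * N) + 8 * (C * ε ^ θ) * N) := by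
        gcongr
        · exact hheat 0
        · exact hheat 1
    _ = _ := by ring

end FinalEstimate

end

/-! ### The theorem -/

theorem theorem2p4 (n : ℕ) [NeZero n] (hn : n = 2 ∨ n = 3) (m : ℕ) (hm : 3 ≤ m)
    (μ ν : ℝ) (hμ : 0 < μ) (hν : 0 < ν) :
    (∀ v0 H0 : Rn n → Rn n,
      MemHmSigma m v0 → MemHmSigma m H0 → Integrable v0 volume → Integrable H0 volume →
      ∀ v H : ℝ → ℝ → Rn n → Rn n,
        (∀ ε, 0 < ε → IsLinearSolution m μ ν ε v0 H0 (v ε) (H ε)) →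
        ∀ x : Rn n, ∀ t : ℝ, 0 < t →
          Tendsto (fun ε => (v ε t x, H ε t x)) (𝓝[>] 0) (𝓝 0)) ∧
    (∀ θ : ℝ, 0 < θ → θ < 1 → ∀ R : ℝ, 0 < R → ∀ l : ℕ, 0 < l → ∀ t₀ : ℝ, 0 < t₀ →
      ∃ C : ℝ, 0 < C ∧
        ∀ v0 H0 : Rn n → Rn n,
          MemHmSigma m v0 → MemHmSigma m H0 → Integrable v0 volume → Integrable H0 volume →
          (∀ᵐ x ∂volume, x ∉ slab n R → v0 x = 0 ∧ H0 x = 0) →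
          ∀ ε : ℝ, 0 < ε → ε < 1 → ∀ v H : ℝ → Rn n → Rn n,
            IsLinearSolution m μ ν ε v0 H0 v H →
              ∀ t : ℝ, t₀ < t →
                eLpNorm (fun x => (v t x, H t x)) ∞ (volume.restrict (slab n (l * R))) ≤
                  ENNReal.ofReal (C * ε ^ θ) * eLpNorm (fun x => (v0 x, H0 x)) 1 volume) := by
  refine ⟨fun v0 H0 _ _ hv0 hH0 v H h x t ht => tendsto_linearSolution_zero hμ hν hv0 hH0 h x ht,
    fun θ hθ hθ1 R _ l _ t₀ ht₀ => ?_⟩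
  obtain ⟨C, hC, hbound⟩ := linearSolution_slab_bound (n := n) hμ hν hθ hθ1 R (l * R) ht₀
  refine ⟨C, hC, fun v0 H0 _ _ hv0 hH0 hsupp ε hε hε1 v H h t ht => ?_⟩
  have hslab : MeasurableSet (slab n (l * R)) := by
    have : Continuous fun x : Rn n => |x 0| :=
      (EuclideanSpace.proj (𝕜 := ℝ) (0 : Fin n)).continuous.abs
    exact (isOpen_lt this continuous_const).measurableSet
  rw [eLpNorm_exponent_top, eLpNorm_one_eq_lintegral_enorm,
    ← ofReal_integral_norm_eq_lintegral_enorm (hv0.prodMk hH0),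
    ← ENNReal.ofReal_mul (by positivity)]
  refine eLpNormEssSup_le_of_ae_bound ((ae_restrict_iff' hslab).2 (Eventually.of_forall
    fun x hx => ?_))
  exact hbound m v0 H0 hv0 hH0 hsupp ε hε hε1 v H h t ht x hx
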